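/- Let $X$ be a separable real Banach space with $\dim X\ge 2$, let $B(x,r)$ be the closed ball, and let $\mathscr H^1$ be the one-dimensional Hausdorff measure of the norm metric, $\mathscr H^1(A)=\sup_{\delta>0}\inf\{\sum_i \operatorname{diam}A_i : A\subset\bigcup_i A_i \text{ a countable cover},\ \operatorname{diam}A_i\le\delta\}$. A \emph{Dini gauge} on $(0,b]$, $0<b<\infty$, is a nondecreasing function $\xi:(0,b]\to[0,\infty)$ with $\lim_{r\to0^+}\xi(r)=0$ and $\int_0^r \xi(\rho)\rho^{-1}\,d\rho<\infty$ for every $0<r\le b$. Let $\xi$ be a Dini gauge on $(0,b]$, let $0<r_0\le b$, and let $U\subset X$ be open. A compact connected set $C\subset X$ is \emph{$(\xi,r_0)$ almost minimizing in $U$} if $\mathscr H^1(C)<\infty$ and, for every $x\in C\cap U$, every $0<r\le r_0$ with $B(x,r)\subset U$ and every compact connected set $C'\subset X$ with $C'\setminus B(x,r)=C\setminus B(x,r)$, $$\mathscr H^1(C\cap B(x,r))\le(1+\xi(r))\,\mathscr H^1(C'\cap B(x,r)).$$ A \emph{Lipschitz curve} is a set $\gamma([\alpha,\beta])$ with $\alpha<\beta$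 and $\gamma:[\alpha,\beta]\to X$ injective and Lipschitz; its endpoints are $\gamma(\alpha)$ and $\gamma(\beta)$. A point $x\in C$ is \emph{regular} if for every $\delta>0$ there is $0<r<\delta$ such that $C\cap B(x,r)$ is a Lipschitz curve and $C\cap\partial B(x,r)$ consists of its two endpoints. Let $\operatorname{reg}(C)$ be the set of regular points of $C$ and $\operatorname{sing}(C)=C\setminus\operatorname{reg}(C)$. \textbf{Theorem.} If $C\subset X$ is compact, connected and $(\xi,r_0)$ almost minimizing in $U$, then 1. $U\cap\operatorname{reg}(C)=U\cap\{x:\Theta^1(\mathscr H^1\llcorner C,x)=1\}$, where $\Theta^1(\mathscr H^1\llcorner C,x)=1$ means that $\lim_{r\to0^+}\mathscr H^1(C\cap B(x,r))/(2r)$ exists and equals $1$; 2. $U\cap\operatorname{sing}(C)$ is relatively closed in $U\cap C$; 3. $\mathscr H^1(U\cap\operatorname{sing}(C))=0$. -/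

import Mathlib

open Set Filter Topology MeasureTheory

/-- `ξ` is a gauge on the interval `(0, b]`: nonnegative, nondecreasing, with limit `0` at `0+`.
The values of `ξ` outside `(0, b]` play no role. -/
structure IsGauge (ξ : ℝ → ℝ) (b : ℝ) : Prop where
  pos : 0 < b
  nonneg : ∀ r ∈ Ioc 0 b, 0 ≤ ξ r
  mono : MonotoneOn ξ (Ioc 0 b)
  tendsto_zero : Tendsto ξ (𝓝[>] 0) (𝓝 0)

/-- A Dini gauge on `(0, b]`: a gauge such that `∫₀ʳ ξ(ρ)/ρ dρ < ∞` for every `r` in `(0, b]`. -/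
structure IsDiniGauge (ξ : ℝ → ℝ) (b : ℝ) : Prop extends IsGauge ξ b where
  dini : ∀ r ∈ Ioc 0 b, IntegrableOn (fun ρ => ξ ρ / ρ) (Ioc 0 r) volume

section Metric

variable {X : Type*} [MetricSpace X]

/-- `C'` is a competitor for `C` in the closed ball `B(x, r)`. -/
structure IsCompetitor (C C' : Set X) (x : X) (r : ℝ) : Prop where
  isCompact : IsCompact C'
  isPreconnected : IsPreconnected C'
  diff_eq : C' \ Metric.closedBall x r = C \ Metric.closedBall x r

/-- The compact connected set `C`, of finite one dimensional Hausdorff measure, is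
`(ξ, r₀)` almost minimizing in `U`. -/
structure IsAlmostMinimizing [MeasurableSpace X] [BorelSpace X]
    (ξ : ℝ → ℝ) (r₀ : ℝ) (U C : Set X) : Prop where
  isCompact : IsCompact C
  isPreconnected : IsPreconnected C
  measure_lt_top : μH[1] C < ⊤
  le_competitor : ∀ x ∈ C ∩ U, ∀ r : ℝ, 0 < r → r ≤ r₀ → Metric.closedBall x r ⊆ U →
    ∀ C' : Set X, IsCompetitor C C' x r →
      μH[1] (C ∩ Metric.closedBall x r) ≤
        ENNReal.ofReal (1 + ξ r) * μH[1] (C' ∩ Metric.closedBall x r)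

/-- The density `Θ¹(ℋ¹ ⌞ C, x) = lim_{r → 0+} ℋ¹(C ∩ B(x, r)) / (2r)` exists and equals `θ`. -/
def HasLinearDensity [MeasurableSpace X] [BorelSpace X]
    (C : Set X) (x : X) (θ : ENNReal) : Prop :=
  Tendsto (fun r : ℝ => μH[1] (C ∩ Metric.closedBall x r) / ENNReal.ofReal (2 * r))
    (𝓝[>] 0) (𝓝 θ)

/-- `Γ` is a Lipschitz curve (the image of a nondegenerate compact interval under an injective
Lipschitz map) with endpoints `p` and `q`. -/
def IsLipschitzCurve (Γ : Set X) (p q : X) : Prop :=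
  ∃ (a b : ℝ) (γ : ℝ → X) (K : NNReal), a < b ∧ LipschitzOnWith K γ (Icc a b) ∧
    InjOn γ (Icc a b) ∧ γ '' Icc a b = Γ ∧ γ a = p ∧ γ b = q

/-- The set of regular points of `C`: the points `x` of `C` having arbitrarily small closed balls
in which `C` is a Lipschitz curve that meets the boundary of the ball exactly at its endpoints. -/
def regularSet (C : Set X) : Set X :=
  {x | x ∈ C ∧ ∀ δ : ℝ, 0 < δ → ∃ r : ℝ, 0 < r ∧ r < δ ∧ ∃ p q : X,
    IsLipschitzCurve (C ∩ Metric.closedBall x r) p q ∧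
      C ∩ frontier (Metric.closedBall x r) = {p, q}}

/-- The set of singular points of `C`. -/
def singularSet (C : Set X) : Set X := C \ regularSet C

end Metric

/-!
The proof compares `C` with other sets in balls `B(x, r)`, and follows the length `φ(r)` of `C` in
`B(x, r)` together with the number `N(r)` of points of `C` on the sphere of radius `r`.

*Density.* Replacing `C` inside the ball by a point, or by a cone over the points on the sphere,
gives `2 ≤ N(r)` (`IsAlmostMinimizing.two_le_encard_sphere`) and `φ(r) ≤ (1 + ξ(r)) r N(r)`
(`IsAlmostMinimizing.ballLength_le_of_encard_le`). By Eilenberg's inequality the first bound yields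
`2r ≤ φ(r)`, and applying this bound to small balls around the points on the sphere gives
`N ≤ φ'` where `φ` is differentiable. Hence `(log φ)' ≥ (1 - ξ) / r`, and the Dini condition makes
`φ(r) / r` nondecreasing up to factors close to one
(`IsAlmostMinimizing.exists_ballLength_mul_le`). Since `N` is an integer, the density is one as soon
as `N(r) = 2` for arbitrarily small `r`, and otherwise `φ(r) ≥ 3r` for all small `r`. So at regular
points the density is one, having density one is an open condition in `C ∩ U`, and the remaining
points form a null set by the Vitali covering theorem
(`hausdorffMeasure_eq_zero_of_three_mul_le`).

*Regularity.* Let `x` have density one, and choose a small `r` such that `C` meets the sphere of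
radius `r` around `x` in two points `p` and `q`. Around every point `y` of `C` in the ball there are
arbitrarily small spheres meeting `C` in two points. Almost minimality prevents the outside of such
a sphere from being connected, as the inside could then be dropped, and it prevents a part of `C`
that is attached at a single point from staying in a small ball
(`IsAlmostMinimizing.not_subset_closedBall`). Therefore the outside has two parts, of which one
contains `p` and the other `q` (`IsAlmostMinimizing.exists_isSplit`). In the limit, `y` cuts
`C ∩ B(x, r)` into a part containing `p` and a part containing `q`. The length of the part
containing `p` is a continuous parameter on `C ∩ B(x, r)` whose inverse is `1`-Lipschitz
(`isLipschitzCurve_of_isCut`), so no general theorem on arcs in continua is needed.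
-/

/-! ### Connected sets and length -/

section Topological

variable {X : Type*} [TopologicalSpace X]

/-- If the part `D` of a connected set `E ∪ D` is replaced by a connected set `S` containing
`E ∩ D`, the result is still connected. -/
theorem IsPreconnected.replace_right {E D S : Set X} (hC : IsPreconnected (E ∪ D))
    (hE : IsClosed E) (hD : IsClosed D) (hDne : D.Nonempty) (hS : IsPreconnected S)
    (hEDS : E ∩ D ⊆ S) : IsPreconnected (E ∪ S) := by
  have key : ∀ u v : Set X, IsClosed u → IsClosed v → E ∪ S ⊆ u ∪ v →
      (E ∪ S) ∩ (u ∩ v) = ∅ → S ⊆ u → E ∪ S ⊆ u := by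
    intro u v hu hv huv hdisj hSu
    have h := (isPreconnected_iff_subset_of_disjoint_closed.1 hC) (E ∩ u ∪ D) (E ∩ v)
      ((hE.inter hu).union hD) (hE.inter hv) ?_ ?_
    · rcases h with h | h
      · rintro z (hz | hz)
        · rcases h (Or.inl hz) with h' | h'
          · exact h'.2
          · exact hSu (hEDS ⟨hz, h'⟩)
        · exact hSu hz
      · obtain ⟨d, hd⟩ := hDne
        have h1 := h (Or.inr hd)
        have h2 := hEDS ⟨h1.1, hd⟩
        exact absurd hdisj (Set.Nonempty.ne_empty ⟨d, Or.inr h2, hSu h2, h1.2⟩)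
    · rintro z (hz | hz)
      · rcases huv (Or.inl hz) with h' | h'
        · exact Or.inl (Or.inl ⟨hz, h'⟩)
        · exact Or.inr ⟨hz, h'⟩
      · exact Or.inl (Or.inr hz)
    · rw [eq_empty_iff_forall_notMem]
      rintro z ⟨-, h1 | h1, h2⟩
      · exact (eq_empty_iff_forall_notMem.1 hdisj) z ⟨Or.inl h1.1, h1.2, h2.2⟩
      · have h3 := hEDS ⟨h2.1, h1⟩
        exact (eq_empty_iff_forall_notMem.1 hdisj) z ⟨Or.inr h3, hSu h3, h2.2⟩
  refine isPreconnected_iff_subset_of_disjoint_closed.2 fun u v hu hv huv hdisj => ?_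
  have hSd : S ∩ (u ∩ v) = ∅ :=
    subset_empty_iff.1 (hdisj ▸ inter_subset_inter_left _ subset_union_right)
  rcases isPreconnected_iff_subset_of_disjoint_closed.1 hS u v hu hv
    (subset_union_right.trans huv) hSd with h | h
  · exact Or.inl (key u v hu hv huv hdisj h)
  · exact Or.inr (key v u hv hu (union_comm u v ▸ huv) (inter_comm u v ▸ hdisj) h)

theorem IsPreconnected.left_of_inter_eq_singleton {P Q : Set X} {a : X}
    (hC : IsPreconnected (P ∪ Q)) (hP : IsClosed P) (hQ : IsClosed Q) (h : P ∩ Q = {a}) :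
    IsPreconnected P := by
  have ha : a ∈ P ∩ Q := h ▸ rfl
  have := hC.replace_right hP hQ ⟨a, ha.2⟩ isPreconnected_singleton h.subset
  rwa [union_eq_left.2 (singleton_subset_iff.2 ha.1)] at this

theorem IsPreconnected.right_of_inter_eq_singleton {P Q : Set X} {a : X}
    (hC : IsPreconnected (P ∪ Q)) (hP : IsClosed P) (hQ : IsClosed Q) (h : P ∩ Q = {a}) :
    IsPreconnected Q :=
  (union_comm P Q ▸ hC).left_of_inter_eq_singleton hQ hP (inter_comm P Q ▸ h)

theorem IsPreconnected.inter_nonempty_of_closed_cover {C P Q : Set X} (hC : IsPreconnected C)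
    (hP : IsClosed P) (hQ : IsClosed Q) (hCPQ : P ∪ Q = C) (hPne : P.Nonempty)
    (hQne : Q.Nonempty) : (P ∩ Q).Nonempty := by
  have := isPreconnected_closed_iff.1 hC P Q hP hQ hCPQ.ge
    (by rwa [← hCPQ, inter_eq_right.2 subset_union_left])
    (by rwa [← hCPQ, inter_eq_right.2 subset_union_right])
  exact this.mono inter_subset_right

end Topological

theorem IsPreconnected.exists_dist_eq {X : Type*} [PseudoMetricSpace X] {C : Set X}
    (hC : IsPreconnected C) {y z : X} (hy : y ∈ C) (hz : z ∈ C) {t : ℝ}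
    (ht0 : 0 ≤ t) (ht : t ≤ dist y z) : ∃ w ∈ C, dist y w = t := by
  have := hC.intermediate_value hy hz (LipschitzWith.dist_right y).continuous.continuousOn
  obtain ⟨w, hw, hwt⟩ := this ⟨by simpa using ht0, ht⟩
  exact ⟨w, hw, hwt⟩

section Length

variable {X : Type*} [MetricSpace X] [MeasurableSpace X] [BorelSpace X]

theorem volume_image_le_hausdorffMeasure_one {f : X → ℝ} (hf : LipschitzWith 1 f) (A : Set X) :
    volume (f '' A) ≤ μH[1] A := by
  have := hf.hausdorffMeasure_image_le zero_le_one A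
  simpa [hausdorffMeasure_real] using this

/-- Eilenberg's inequality, for a constant lower bound on the number of points in the fibres. -/
theorem natCast_mul_volume_le_hausdorffMeasure [SecondCountableTopology X] {f : X → ℝ}
    (hf : LipschitzWith 1 f) {A : Set X} (hA : MeasurableSet A) {T : Set ℝ}
    (hT : MeasurableSet T) (N : ℕ) (hN : ∀ t ∈ T, (N : ℕ∞) ≤ (A ∩ f ⁻¹' {t}).encard) :
    (N : ENNReal) * volume T ≤ μH[1] A := by
  rcases isEmpty_or_nonempty X with hX | hX
  · have hA0 : A = ∅ := eq_empty_of_isEmpty A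
    rcases T.eq_empty_or_nonempty with rfl | ⟨t, ht⟩
    · simp
    · have := hN t ht
      simp [hA0] at this
      simp [this]
  -- `P n` is a partition of the space into pieces of diameter at most `2 / (n + 1)`, and `g n t`
  -- counts the pieces of `A` whose image contains `t`, images being replaced by measurable hulls
  let P : ℕ → ℕ → Set X := fun n =>
    disjointed fun i => Metric.closedBall (TopologicalSpace.denseSeq X i) (1 / ((n : ℝ) + 1))
  have hPm : ∀ n i, MeasurableSet (P n i) := fun n i =>
    MeasurableSet.disjointed (fun _ => Metric.isClosed_closedBall.measurableSet) i
  have hPu : ∀ n, ⋃ i, P n i = univ := by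
    intro n
    rw [iUnion_disjointed, eq_univ_iff_forall]
    intro x
    have hn : (0 : ℝ) < 1 / ((n : ℝ) + 1) := by positivity
    obtain ⟨i, hi⟩ := (TopologicalSpace.denseRange_denseSeq X).exists_dist_lt x hn
    exact mem_iUnion.2 ⟨i, Metric.mem_closedBall.2 hi.le⟩
  have hPd : ∀ n i x y, x ∈ P n i → y ∈ P n i → dist x y ≤ 2 / ((n : ℝ) + 1) := by
    intro n i x y hx hy
    have hx := Metric.mem_closedBall.1 (disjointed_subset _ i hx)
    have hy := Metric.mem_closedBall'.1 (disjointed_subset _ i hy)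
    have := dist_triangle x (TopologicalSpace.denseSeq X i) y
    have h2 : 2 / ((n : ℝ) + 1) = 1 / ((n : ℝ) + 1) + 1 / ((n : ℝ) + 1) := by ring
    linarith
  let g : ℕ → ℝ → ENNReal := fun n t =>
    ∑' i, (toMeasurable volume (f '' (A ∩ P n i))).indicator 1 t
  have hgm1 : ∀ n i, Measurable fun t =>
      (toMeasurable volume (f '' (A ∩ P n i))).indicator (1 : ℝ → ENNReal) t := fun n i =>
    measurable_one.indicator (measurableSet_toMeasurable _ _)
  have hgm : ∀ n, Measurable (g n) := fun n => Measurable.tsum (hgm1 n)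
  have hgi : ∀ n, ∫⁻ t, g n t ≤ μH[1] A := by
    intro n
    change ∫⁻ t, ∑' i, _ ≤ _
    rw [lintegral_tsum fun i => (hgm1 n i).aemeasurable]
    calc ∑' i, ∫⁻ t, (toMeasurable volume (f '' (A ∩ P n i))).indicator 1 t
        ≤ ∑' i, μH[1] (A ∩ P n i) := by
          refine ENNReal.tsum_le_tsum fun i => ?_
          rw [lintegral_indicator_one (measurableSet_toMeasurable _ _), measure_toMeasurable]
          exact volume_image_le_hausdorffMeasure_one hf _
      _ = μH[1] A := by
          rw [← measure_iUnion, ← inter_iUnion, hPu, inter_univ]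
          · intro i j hij
            exact ((disjoint_disjointed _) hij).mono inter_subset_right inter_subset_right
          · exact fun i => hA.inter (hPm n i)
  have hlow : ∀ t ∈ T, (N : ENNReal) ≤ liminf (fun n => g n t) atTop := by
    intro t ht
    obtain ⟨F, hFsub, hFcard⟩ := exists_subset_encard_eq (hN t ht)
    have hFfin : F.Finite := finite_of_encard_eq_coe hFcard
    refine le_liminf_of_le (by isBoundedDefault) ?_
    -- a fine partition separates `N` points of the fibre
    have hev : ∀ᶠ n : ℕ in atTop, ∀ x ∈ F, ∀ y ∈ F, x ≠ y → 2 / ((n : ℝ) + 1) < dist x y := by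
      refine (eventually_all_finite hFfin).2 fun x _ =>
        (eventually_all_finite hFfin).2 fun y _ => ?_
      by_cases hxy : x = y
      · exact Eventually.of_forall fun n h => absurd hxy h
      · have hlim : Tendsto (fun n : ℕ => 2 * (1 / ((n : ℝ) + 1))) atTop (𝓝 (2 * 0)) :=
          tendsto_one_div_add_atTop_nhds_zero_nat.const_mul 2
        rw [mul_zero] at hlim
        filter_upwards [hlim.eventually_lt_const (dist_pos.2 hxy)] with n hn _
        rwa [mul_one_div] at hn
    filter_upwards [hev] with n hn
    have hex : ∀ x : X, ∃ i, x ∈ P n i := fun x => mem_iUnion.1 (hPu n ▸ mem_univ x)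
    choose ι hι using hex
    have hinj : InjOn ι F := by
      intro x hx y hy hxy
      by_contra hne
      exact absurd (hPd n (ι x) x y (hι x) (hxy ▸ hι y)) (not_le.2 (hn x hx y hy hne))
    have hcard : hFfin.toFinset.card = N := by
      rw [hFfin.encard_eq_coe_toFinset_card] at hFcard
      exact_mod_cast hFcard
    calc (N : ENNReal) = ∑ x ∈ hFfin.toFinset, 1 := by simp [hcard]
      _ = ∑ x ∈ hFfin.toFinset,
            (toMeasurable volume (f '' (A ∩ P n (ι x)))).indicator (1 : ℝ → ENNReal) t := by
          refine Finset.sum_congr rfl fun x hx => ?_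
          have hxF := hFsub (hFfin.mem_toFinset.1 hx)
          rw [indicator_of_mem, Pi.one_apply]
          exact subset_toMeasurable _ _ ⟨x, ⟨hxF.1, hι x⟩, hxF.2⟩
      _ = ∑ i ∈ hFfin.toFinset.image ι,
            (toMeasurable volume (f '' (A ∩ P n i))).indicator (1 : ℝ → ENNReal) t := by
          rw [Finset.sum_image]
          intro x hx y hy h
          exact hinj (by simpa using hx) (by simpa using hy) h
      _ ≤ g n t := ENNReal.sum_le_tsum _
  calc (N : ENNReal) * volume T = ∫⁻ _ in T, (N : ENNReal) := by simp
    _ ≤ ∫⁻ t in T, liminf (fun n => g n t) atTop := setLIntegral_mono' hT hlow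
    _ ≤ ∫⁻ t, liminf (fun n => g n t) atTop := setLIntegral_le_lintegral _ _
    _ ≤ liminf (fun n => ∫⁻ t, g n t) atTop := lintegral_liminf_le hgm
    _ ≤ μH[1] A := liminf_le_of_le (by isBoundedDefault) fun b hb => by
        obtain ⟨n, hn⟩ := hb.exists
        exact hn.trans (hgi n)

theorem IsPreconnected.ofReal_le_hausdorffMeasure_inter_closedBall {C : Set X}
    (hC : IsPreconnected C) {y z : X} (hy : y ∈ C) (hz : z ∈ C) {t : ℝ} (ht : t ≤ dist y z) :
    ENNReal.ofReal t ≤ μH[1] (C ∩ Metric.closedBall y t) := by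
  have hsub : Icc 0 t ⊆ (fun w => dist y w) '' (C ∩ Metric.closedBall y t) := by
    intro s hs
    obtain ⟨w, hw, hws⟩ := hC.exists_dist_eq hy hz hs.1 (hs.2.trans ht)
    exact ⟨w, ⟨hw, Metric.mem_closedBall'.2 (hws.trans_le hs.2)⟩, hws⟩
  calc ENNReal.ofReal t = volume (Icc 0 t) := by simp
    _ ≤ _ := measure_mono hsub
    _ ≤ _ := volume_image_le_hausdorffMeasure_one (LipschitzWith.dist_right y) _

theorem IsPreconnected.edist_le_hausdorffMeasure {C : Set X} (hC : IsPreconnected C) {y z : X}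
    (hy : y ∈ C) (hz : z ∈ C) : edist y z ≤ μH[1] C := by
  rw [edist_dist]
  exact (hC.ofReal_le_hausdorffMeasure_inter_closedBall hy hz le_rfl).trans
    (measure_mono inter_subset_left)

end Length

/-! ### Cut points and Lipschitz curves -/

section Cut

variable {X : Type*} [TopologicalSpace X]

/-- `y` cuts `K` into two closed connected pieces `L ∋ p` and `R ∋ q` which meet only at `y`.
A piece is allowed to be `{y}`, so that the endpoints `p` and `q` can be treated like the other
points. -/
structure IsCut (K : Set X) (p q y : X) (L R : Set X) : Prop where
  isClosed_left : IsClosed L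
  isClosed_right : IsClosed R
  isPreconnected_left : IsPreconnected L
  isPreconnected_right : IsPreconnected R
  union_eq : L ∪ R = K
  inter_eq : L ∩ R = {y}
  left_mem : p ∈ L
  right_mem : q ∈ R

namespace IsCut

variable {K L R L' R' : Set X} {p q y z : X}

theorem symm (h : IsCut K p q y L R) : IsCut K q p y R L where
  isClosed_left := h.isClosed_right
  isClosed_right := h.isClosed_left
  isPreconnected_left := h.isPreconnected_right
  isPreconnected_right := h.isPreconnected_left
  union_eq := union_comm L R ▸ h.union_eq
  inter_eq := inter_comm L R ▸ h.inter_eq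
  left_mem := h.right_mem
  right_mem := h.left_mem

theorem mem_left (h : IsCut K p q y L R) : y ∈ L := (h.inter_eq.ge rfl).1

theorem mem_right (h : IsCut K p q y L R) : y ∈ R := (h.inter_eq.ge rfl).2

theorem eq_of_mem_of_mem (h : IsCut K p q y L R) (hL : z ∈ L) (hR : z ∈ R) : z = y :=
  h.inter_eq.le ⟨hL, hR⟩

theorem left_subset (h : IsCut K p q y L R) : L ⊆ K := h.union_eq ▸ subset_union_left

theorem isPreconnected (h : IsCut K p q y L R) : IsPreconnected K :=
  h.union_eq ▸ h.isPreconnected_left.union y h.mem_left h.mem_right h.isPreconnected_right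

/-- The cuts are linearly ordered: `L` is connected and avoids `z`, so it lies on the side of `p`. -/
theorem left_subset_left (h : IsCut K p q y L R) (h' : IsCut K p q z L' R') (hz : z ∈ R)
    (hzy : z ≠ y) : L ⊆ L' := by
  have hzL : z ∉ L := fun hzL => hzy (h.eq_of_mem_of_mem hzL hz)
  have := isPreconnected_iff_subset_of_disjoint_closed.1 h.isPreconnected_left L' R'
    h'.isClosed_left h'.isClosed_right (h'.union_eq ▸ h.left_subset)
    (by rwa [h'.inter_eq, inter_singleton_eq_empty])
  refine this.resolve_right fun hLR => hzL ?_
  exact h'.eq_of_mem_of_mem h'.left_mem (hLR h.left_mem) ▸ h.left_mem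

theorem right_subset_right (h : IsCut K p q y L R) (h' : IsCut K p q z L' R') (hz : z ∈ R)
    (hzy : z ≠ y) : R' ⊆ R :=
  h'.symm.left_subset_left h.symm (h.left_subset_left h' hz hzy h.mem_left) hzy.symm

theorem isPreconnected_right_inter_left (h : IsCut K p q y L R) (h' : IsCut K p q z L' R')
    (hz : z ∈ R) (hzy : z ≠ y) : IsPreconnected (R ∩ L') := by
  have hRK : R ⊆ L' ∪ R' := by rw [h'.union_eq]; exact h.symm.left_subset
  have hR : R ∩ L' ∪ R' = R := by
    refine subset_antisymm
      (union_subset inter_subset_left (h.right_subset_right h' hz hzy)) fun w hw => ?_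
    exact (hRK hw).imp (fun h => ⟨hw, h⟩) id
  have hz' : R ∩ L' ∩ R' = {z} := by
    rw [inter_assoc, h'.inter_eq, inter_eq_right.2 (singleton_subset_iff.2 hz)]
  exact (hR.symm ▸ h.isPreconnected_right : IsPreconnected (R ∩ L' ∪ R')).left_of_inter_eq_singleton
    (h.isClosed_right.inter h'.isClosed_left) h'.isClosed_right hz'

end IsCut

end Cut

section Arc

variable {X : Type*} [MetricSpace X] [MeasurableSpace X] [BorelSpace X]

/-- The piece between two cut points is connected, so it is at least as long as their distance. -/
theorem IsCut.edist_add_le {K L R L' R' : Set X} {p q y z : X} (h : IsCut K p q y L R)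
    (h' : IsCut K p q z L' R') (hz : z ∈ R) (hzy : z ≠ y) :
    edist y z + μH[1] L ≤ μH[1] L' := by
  have := Measure.nullSingletonClass_hausdorff X one_pos
  have hL := h.left_subset_left h' hz hzy
  have hdisj : AEDisjoint μH[1] (R ∩ L') L := by
    refine measure_mono_null (t := {y}) (fun w hw => ?_) (measure_singleton y)
    exact h.eq_of_mem_of_mem hw.2 hw.1.1
  calc edist y z + μH[1] L ≤ μH[1] (R ∩ L') + μH[1] L := by
        gcongr
        exact (h.isPreconnected_right_inter_left h' hz hzy).edist_le_hausdorffMeasure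
          ⟨h.mem_right, hL h.mem_left⟩ ⟨hz, h'.mem_left⟩
    _ = μH[1] (R ∩ L' ∪ L) := (measure_union₀ h.isClosed_left.nullMeasurableSet hdisj).symm
    _ ≤ μH[1] L' := measure_mono (union_subset inter_subset_right hL)
/-- A cut at `z` close to `y` has almost the same left piece as the cut at `y`: away from `y`, the
left pieces converge pointwise, so that their lengths converge as well. -/
theorem continuous_hausdorffMeasure_left {K : Set X} {p q : X} (hK : μH[1] K ≠ ⊤)
    {L R : X → Set X} (h : ∀ y ∈ K, IsCut K p q y (L y) (R y)) :
    Continuous fun y : K => μH[1] (L y) := by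
  have := Measure.nullSingletonClass_hausdorff X one_pos
  refine continuous_iff_continuousAt.2 fun y => ?_
  refine tendsto_measure_of_ae_tendsto_indicator (𝓝 y) (α := X) (A := L y)
    (As := fun z : K => L z) (B := K)
    (h y y.2).isClosed_left.measurableSet
    (fun z => (h z z.2).isClosed_left.measurableSet)
    ((h y y.2).union_eq ▸ ((h y y.2).isClosed_left.union (h y y.2).isClosed_right).measurableSet)
    hK (Eventually.of_forall fun z => (h z z.2).left_subset) ?_
  have hae : ∀ᵐ w ∂(μH[1] : Measure X), w ≠ (y : X) := by
    rw [ae_iff]; simp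
  filter_upwards [hae] with w hwy
  by_cases hwK : w ∈ K
  swap
  · exact Eventually.of_forall fun z =>
      ⟨fun hw => absurd ((h z z.2).left_subset hw) hwK,
        fun hw => absurd ((h y y.2).left_subset hw) hwK⟩
  have hw := h w hwK
  have hyK : (y : X) ∈ L w ∪ R w := hw.union_eq.ge y.2
  have hwyK : w ∈ L y ∪ R y := (h y y.2).union_eq.ge hwK
  rcases hyK with hy | hy
  · have hyR : (y : X) ∉ R w := fun hR => hwy (hw.eq_of_mem_of_mem hy hR).symm
    have hwL : w ∉ L y := fun hL => by
      have hwR := (hw.symm.left_subset_left (h y y.2).symm hy hwy.symm) hw.mem_right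
      exact hwy ((h y y.2).eq_of_mem_of_mem hL hwR)
    have hev : ∀ᶠ z : K in 𝓝 y, (z : X) ∉ R w :=
      continuous_subtype_val.continuousAt.eventually (hw.isClosed_right.isOpen_compl.mem_nhds hyR)
    filter_upwards [hev] with z hz
    have hzL : (z : X) ∈ L w := (hw.union_eq.ge z.2).resolve_right hz
    have hzw : (z : X) ≠ w := fun e => hz (e ▸ hw.mem_right)
    refine iff_of_false (fun hL => ?_) hwL
    have hwR := (hw.symm.left_subset_left (h z z.2).symm hzL hzw) hw.mem_right
    exact hzw ((h z z.2).eq_of_mem_of_mem hL hwR).symm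
  · have hyL : (y : X) ∉ L w := fun hL => hwy (hw.eq_of_mem_of_mem hL hy).symm
    have hwL : w ∈ L y := (hw.left_subset_left (h y y.2) hy hwy.symm) hw.mem_left
    have hev : ∀ᶠ z : K in 𝓝 y, (z : X) ∉ L w :=
      continuous_subtype_val.continuousAt.eventually (hw.isClosed_left.isOpen_compl.mem_nhds hyL)
    filter_upwards [hev] with z hz
    have hzR : (z : X) ∈ R w := (hw.union_eq.ge z.2).resolve_left hz
    have hzw : (z : X) ≠ w := fun e => hz (e ▸ hw.mem_left)
    exact iff_of_true ((hw.left_subset_left (h z z.2) hzR hzw) hw.mem_left) hwL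

/-- A set of finite length all of whose points cut it between `p` and `q` is a Lipschitz curve from
`p` to `q`: the length of the left piece is a parameter, and the inverse of this parametrization is
`1`-Lipschitz because connected sets are at least as long as the distance of any two points. -/
theorem isLipschitzCurve_of_isCut {K : Set X} {p q : X} (hK : μH[1] K ≠ ⊤) (hpq : p ≠ q)
    (hp : p ∈ K) (hcut : ∀ y ∈ K, ∃ L R, IsCut K p q y L R) : IsLipschitzCurve K p q := by
  choose! L R h using hcut
  have hq : q ∈ K := (h p hp).symm.left_subset (h p hp).right_mem
  have hfin : ∀ y ∈ K, μH[1] (L y) ≠ ⊤ := fun y hy =>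
    measure_ne_top_of_subset (h y hy).left_subset hK
  let f : X → ℝ := fun y => (μH[1] (L y)).toReal
  have hcont : Continuous fun y : K => f y :=
    continuous_iff_continuousAt.2 fun y => (ENNReal.tendsto_toReal (hfin y y.2)).comp
      ((continuous_hausdorffMeasure_left hK h).tendsto y)
  have hadd : ∀ y ∈ K, ∀ z ∈ K, z ∈ R y → dist y z + f y ≤ f z := by
    intro y hy z hz hzR
    rcases eq_or_ne z y with rfl | hzy
    · simp
    have := (h y hy).edist_add_le (h z hz) hzR hzy
    have := ENNReal.toReal_mono (hfin z hz) this
    rwa [ENNReal.toReal_add (edist_ne_top _ _) (hfin y hy), ← dist_edist] at this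
  have hdist : ∀ y ∈ K, ∀ z ∈ K, dist y z ≤ dist (f y) (f z) := by
    intro y hy z hz
    rw [Real.dist_eq]
    rcases (h y hy).union_eq.ge hz with hzL | hzR
    · have : y ∈ R z := by
        rcases eq_or_ne z y with rfl | hzy
        · exact (h z hz).mem_right
        · exact ((h y hy).symm.left_subset_left (h z hz).symm hzL hzy) (h y hy).mem_right
      have := hadd z hz y hy this
      rw [dist_comm y z]
      exact (by linarith : dist z y ≤ f y - f z).trans (le_abs_self _)
    · have := hadd y hy z hz hzR
      rw [abs_sub_comm]
      exact (by linarith : dist y z ≤ f z - f y).trans (le_abs_self _)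
  have hinj : ∀ y ∈ K, ∀ z ∈ K, f y = f z → y = z := fun y hy z hz hyz =>
    dist_le_zero.1 ((hdist y hy z hz).trans (by simp [hyz]))
  have hpR : ∀ y ∈ K, y ∈ R p := fun y hy => by
    rcases eq_or_ne y p with rfl | hyp
    · exact (h y hy).mem_right
    · exact (h y hy).symm.left_subset_left (h p hp).symm (h y hy).left_mem hyp.symm
        (h y hy).mem_right
  have hqR : ∀ y ∈ K, q ∈ R y := fun y hy => (h y hy).right_mem
  have hfp : ∀ y ∈ K, f p ≤ f y := fun y hy =>
    (le_add_of_nonneg_left dist_nonneg).trans (hadd p hp y hy (hpR y hy))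
  have hfq : ∀ y ∈ K, f y ≤ f q := fun y hy =>
    (le_add_of_nonneg_left dist_nonneg).trans (hadd y hy q hq (hqR y hy))
  have hsurj : ∀ t ∈ Icc (f p) (f q), ∃ y ∈ K, f y = t := by
    intro t ht
    have : ContinuousOn f K := continuousOn_iff_continuous_domRestrict.2 hcont
    exact (h p hp).isPreconnected.intermediate_value hp hq this ht
  have : Nonempty X := ⟨p⟩
  choose! γ hγK hγ using hsurj
  have hγf : ∀ y ∈ K, γ (f y) = y := fun y hy =>
    have hy' : f y ∈ Icc (f p) (f q) := ⟨hfp y hy, hfq y hy⟩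
    hinj _ (hγK _ hy') _ hy (hγ _ hy')
  refine ⟨f p, f q, γ, 1, ?_, ?_, ?_, ?_, hγf p hp, hγf q hq⟩
  · exact lt_of_le_of_ne (hfp q hq) fun e => hpq (hinj p hp q hq e)
  · refine LipschitzOnWith.of_dist_le_mul fun s hs t ht => ?_
    rw [NNReal.coe_one, one_mul]
    exact (hdist _ (hγK s hs) _ (hγK t ht)).trans_eq (by rw [hγ s hs, hγ t ht])
  · intro s hs t ht hst
    rw [← hγ s hs, ← hγ t ht, hst]
  · refine subset_antisymm (image_subset_iff.2 hγK) fun y hy => ?_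
    exact ⟨f y, ⟨hfp y hy, hfq y hy⟩, hγf y hy⟩

end Arc

/-! ### Comparison sets -/

section Competitors

theorem diff_ball_inter_closedBall {X : Type*} [PseudoMetricSpace X] (C : Set X) (x : X) (r : ℝ) :
    (C \ Metric.ball x r) ∩ (C ∩ Metric.closedBall x r) = C ∩ Metric.sphere x r := by
  rw [← Metric.closedBall_sdiff_ball]; grind

theorem diff_ball_union_closedBall {X : Type*} [PseudoMetricSpace X] (C : Set X) (x : X) (r : ℝ) :
    (C \ Metric.ball x r) ∪ (C ∩ Metric.closedBall x r) = C := by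
  have := Metric.ball_subset_closedBall (x := x) (ε := r)
  grind

variable {X : Type*} [MetricSpace X] [MeasurableSpace X] [BorelSpace X]
variable {ξ : ℝ → ℝ} {r₀ : ℝ} {U C : Set X}

namespace IsAlmostMinimizing

/-- Comparison with the set obtained by replacing `C` in a ball by a connected set `S` that contains
all points of `C` on the boundary sphere. -/
theorem measure_le_of_replace (hC : IsAlmostMinimizing ξ r₀ U C) {x : X} (hx : x ∈ C ∩ U) {r : ℝ}
    (hr : 0 < r) (hr₀ : r ≤ r₀) (hrU : Metric.closedBall x r ⊆ U) {S : Set X} (hS : IsCompact S)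
    (hSc : IsPreconnected S) (hSr : S ⊆ Metric.closedBall x r) (hCS : C ∩ Metric.sphere x r ⊆ S) :
    μH[1] (C ∩ Metric.closedBall x r) ≤ ENNReal.ofReal (1 + ξ r) * μH[1] S := by
  have hb := Metric.ball_subset_closedBall (x := x) (ε := r)
  have hs := Metric.closedBall_sdiff_ball (x := x) (ε := r)
  have h1 : ((C \ Metric.ball x r) ∪ S) ∩ Metric.closedBall x r = S := by
    rw [← hs] at hCS; grind
  have := hC.le_competitor x hx r hr hr₀ hrU ((C \ Metric.ball x r) ∪ S) ⟨?_, ?_, by grind⟩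
  · rwa [h1] at this
  · exact (hC.isCompact.diff Metric.isOpen_ball).union hS
  · refine IsPreconnected.replace_right (D := C ∩ Metric.closedBall x r) ?_
      (hC.isCompact.diff Metric.isOpen_ball).isClosed
      (hC.isCompact.isClosed.inter Metric.isClosed_closedBall)
      ⟨x, hx.1, Metric.mem_closedBall_self hr.le⟩ hSc ?_
    · rw [diff_ball_union_closedBall]; exact hC.isPreconnected
    · rwa [diff_ball_inter_closedBall]

theorem measure_inter_closedBall_pos (hC : IsAlmostMinimizing ξ r₀ U C) (hne : C.Nontrivial) {y : X}
    (hy : y ∈ C) {r : ℝ} (hr : 0 < r) : 0 < μH[1] (C ∩ Metric.closedBall y r) := by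
  obtain ⟨z, hz, hzy⟩ := hne.exists_ne y
  have h := hC.isPreconnected.ofReal_le_hausdorffMeasure_inter_closedBall hy hz (min_le_right r _)
  refine (ENNReal.ofReal_pos.2 (lt_min hr (dist_pos.2 hzy.symm))).trans_le (h.trans ?_)
  exact measure_mono (inter_subset_inter_right _ (Metric.closedBall_subset_closedBall
    (min_le_left _ _)))

/-- Almost minimizing sets have no free ends: a set that meets a sphere at most once could be
shrunk to a point inside. -/
theorem two_le_encard_sphere (hC : IsAlmostMinimizing ξ r₀ U C) (hne : C.Nontrivial) {x : X}
    (hx : x ∈ C ∩ U) {r : ℝ} (hr : 0 < r) (hr₀ : r ≤ r₀) (hrU : Metric.closedBall x r ⊆ U) :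
    2 ≤ (C ∩ Metric.sphere x r).encard := by
  have := Measure.nullSingletonClass_hausdorff X one_pos
  by_contra! h
  have hle : (C ∩ Metric.sphere x r).encard ≤ 1 := by
    rw [← one_add_one_eq_two] at h
    exact Order.le_of_lt_add_one h
  have hsub := encard_le_one_iff_subsingleton.1 hle
  obtain ⟨s, hs, hsr⟩ : ∃ s ∈ Metric.closedBall x r, C ∩ Metric.sphere x r ⊆ {s} := by
    rcases (C ∩ Metric.sphere x r).eq_empty_or_nonempty with he | ⟨p, hp⟩
    · exact ⟨x, Metric.mem_closedBall_self hr.le, by simp [he]⟩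
    · exact ⟨p, Metric.sphere_subset_closedBall hp.2, fun z hz => hsub hz hp⟩
  have := hC.measure_le_of_replace hx hr hr₀ hrU isCompact_singleton isPreconnected_singleton
    (singleton_subset_iff.2 hs) hsr
  rw [measure_singleton, mul_zero] at this
  exact absurd (hC.measure_inter_closedBall_pos hne hx.1 hr) (not_lt.2 this)

theorem measurableSet (hC : IsAlmostMinimizing ξ r₀ U C) : MeasurableSet C :=
  hC.isCompact.isClosed.measurableSet

theorem natCast_mul_le_measure_ball [SecondCountableTopology X]
    (hC : IsAlmostMinimizing ξ r₀ U C) {y : X} {r : ℝ} (N : ℕ)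
    (hN : ∀ t ∈ Ioo 0 r, (N : ℕ∞) ≤ (C ∩ Metric.sphere y t).encard) :
    (N : ENNReal) * ENNReal.ofReal r ≤ μH[1] (C ∩ Metric.ball y r) := by
  have := natCast_mul_volume_le_hausdorffMeasure (LipschitzWith.dist_right y)
    (hC.measurableSet.inter Metric.isOpen_ball.measurableSet) measurableSet_Ioo N
    (A := C ∩ Metric.ball y r) (T := Ioo 0 r) fun t ht => (hN t ht).trans (encard_le_encard ?_)
  · simpa using this
  · rintro z ⟨hz, hzt⟩
    have hzt : dist z y = t := hzt
    exact ⟨⟨hz, Metric.mem_ball.2 (hzt.trans_lt ht.2)⟩, (dist_comm y z).trans hzt⟩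

theorem two_mul_le_measure_ball [SecondCountableTopology X]
    (hC : IsAlmostMinimizing ξ r₀ U C) (hne : C.Nontrivial) {x : X}
    (hx : x ∈ C ∩ U) {r : ℝ} (hr₀ : r ≤ r₀) (hrU : Metric.closedBall x r ⊆ U) :
    2 * ENNReal.ofReal r ≤ μH[1] (C ∩ Metric.ball x r) :=
  hC.natCast_mul_le_measure_ball 2 fun _ ht =>
    hC.two_le_encard_sphere hne hx ht.1 (ht.2.le.trans hr₀)
      ((Metric.closedBall_subset_closedBall ht.2.le).trans hrU)

end IsAlmostMinimizing

end Competitors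

section Cone

variable {X : Type*} [NormedAddCommGroup X] [NormedSpace ℝ X] [MeasurableSpace X] [BorelSpace X]
variable {ξ : ℝ → ℝ} {r₀ : ℝ} {U C : Set X}

/-- Comparison with the cone over the points of `C` on the boundary sphere. -/
theorem IsAlmostMinimizing.measure_le_of_encard_le (hC : IsAlmostMinimizing ξ r₀ U C) {x : X}
    (hx : x ∈ C ∩ U) {r : ℝ} (hr : 0 < r) (hr₀ : r ≤ r₀) (hrU : Metric.closedBall x r ⊆ U) {N : ℕ}
    (hN : (C ∩ Metric.sphere x r).encard ≤ N) :
    μH[1] (C ∩ Metric.closedBall x r) ≤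
      ENNReal.ofReal (1 + ξ r) * (N * ENNReal.ofReal r) := by
  have hfin : (C ∩ Metric.sphere x r).Finite := finite_of_encard_le_coe hN
  have hcard : hfin.toFinset.card ≤ N := by
    rw [hfin.encard_eq_coe_toFinset_card] at hN
    exact_mod_cast hN
  have hmem : ∀ p ∈ hfin.toFinset, dist x p = r := fun p hp => by
    rw [dist_comm]; exact (hfin.mem_toFinset.1 hp).2
  refine (hC.measure_le_of_replace hx hr hr₀ hrU
    (S := ⋃ p ∈ hfin.toFinset, segment ℝ x p) ?_ ?_ ?_ ?_).trans ?_
  · exact hfin.toFinset.isCompact_biUnion fun p _ => by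
      rw [segment_eq_image_lineMap]
      exact isCompact_Icc.image AffineMap.lineMap_continuous
  · refine isPreconnected_of_forall x fun z hz => ?_
    obtain ⟨p, hp, hz⟩ := mem_iUnion₂.1 hz
    exact ⟨segment ℝ x p, subset_iUnion₂_of_subset p hp subset_rfl, left_mem_segment ℝ x p, hz,
      (convex_segment x p).isPreconnected⟩
  · refine iUnion₂_subset fun p hp => ?_
    exact (convex_closedBall x r).segment_subset (Metric.mem_closedBall_self hr.le)
      (Metric.mem_closedBall'.2 (hmem p hp).le)
  · intro p hp
    exact mem_biUnion (hfin.mem_toFinset.2 hp) (right_mem_segment ℝ x p)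
  · gcongr
    calc μH[1] (⋃ p ∈ hfin.toFinset, segment ℝ x p)
        ≤ ∑ p ∈ hfin.toFinset, μH[1] (segment ℝ x p) := measure_biUnion_finset_le _ _
      _ = ∑ p ∈ hfin.toFinset, ENNReal.ofReal r := Finset.sum_congr rfl fun p hp => by
          rw [hausdorffMeasure_segment, edist_dist, hmem p hp]
      _ ≤ N * ENNReal.ofReal r := by
          rw [Finset.sum_const, nsmul_eq_mul]
          gcongr

end Cone

/-! ### Almost monotonicity of the length in balls -/

/-- The length of `C` in the closed ball `B(x, r)`, as a real number. -/
noncomputable def ballLength {X : Type*} [MetricSpace X] [MeasurableSpace X] [BorelSpace X]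
    (C : Set X) (x : X) (r : ℝ) : ℝ :=
  (μH[1] (C ∩ Metric.closedBall x r)).toReal

namespace IsAlmostMinimizing

section Metric

variable {X : Type*} [MetricSpace X] [MeasurableSpace X] [BorelSpace X]
variable {ξ : ℝ → ℝ} {r₀ : ℝ} {U C : Set X}

theorem measure_inter_ne_top (hC : IsAlmostMinimizing ξ r₀ U C) (A : Set X) :
    μH[1] (C ∩ A) ≠ ⊤ :=
  measure_ne_top_of_subset inter_subset_left hC.measure_lt_top.ne

theorem ballLength_mono (hC : IsAlmostMinimizing ξ r₀ U C) (x : X) : Monotone (ballLength C x) :=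
  fun _ _ hst => ENNReal.toReal_mono (hC.measure_inter_ne_top _)
    (measure_mono (inter_subset_inter_right _ (Metric.closedBall_subset_closedBall hst)))

theorem ballLength_le_of_subset (hC : IsAlmostMinimizing ξ r₀ U C) {x y : X} {r s : ℝ}
    (h : Metric.closedBall x r ⊆ Metric.closedBall y s) : ballLength C x r ≤ ballLength C y s :=
  ENNReal.toReal_mono (hC.measure_inter_ne_top _)
    (measure_mono (inter_subset_inter_right _ h))

theorem ballLength_pos (hC : IsAlmostMinimizing ξ r₀ U C) (hne : C.Nontrivial) {y : X}
    (hy : y ∈ C) {r : ℝ} (hr : 0 < r) : 0 < ballLength C y r :=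
  ENNReal.toReal_pos (hC.measure_inter_closedBall_pos hne hy hr).ne' (hC.measure_inter_ne_top _)

theorem natCast_mul_le_ballLength [SecondCountableTopology X]
    (hC : IsAlmostMinimizing ξ r₀ U C) {y : X} {r : ℝ} (hr : 0 ≤ r) (N : ℕ)
    (hN : ∀ t ∈ Ioo 0 r, (N : ℕ∞) ≤ (C ∩ Metric.sphere y t).encard) :
    N * r ≤ ballLength C y r := by
  have h := (hC.natCast_mul_le_measure_ball N hN).trans
    (measure_mono (inter_subset_inter_right _ Metric.ball_subset_closedBall))
  have := ENNReal.toReal_mono (hC.measure_inter_ne_top _) h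
  simpa [hr, ballLength] using this

/-- If `C` has `n` points on the sphere of radius `r`, then it has length at least `2nh` in the
annulus with radii `r - h` and `r + h`, for small `h`: disjoint balls around the `n` points lie in
the annulus. -/
theorem natCast_le_deriv_ballLength [SecondCountableTopology X]
    (hC : IsAlmostMinimizing ξ r₀ U C) (hne : C.Nontrivial) (h₀ : 0 < r₀) (hU : IsOpen U)
    {x : X} {r : ℝ} (hrU : Metric.closedBall x r ⊆ U)
    (hd : DifferentiableAt ℝ (ballLength C x) r) {n : ℕ}
    (hn : (n : ℕ∞) ≤ (C ∩ Metric.sphere x r).encard) : (n : ℝ) ≤ deriv (ballLength C x) r := by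
  obtain ⟨F, hFsub, hFcard⟩ := exists_subset_encard_eq hn
  have hFfin : F.Finite := finite_of_encard_eq_coe hFcard
  have hcard : hFfin.toFinset.card = n := by
    rw [hFfin.encard_eq_coe_toFinset_card] at hFcard
    exact_mod_cast hFcard
  have hsmall : ∀ a : ℝ, 0 < a → ∀ᶠ h : ℝ in 𝓝[>] 0, h < a := fun a ha =>
    nhdsWithin_le_nhds (eventually_lt_nhds ha)
  have hev : ∀ᶠ h : ℝ in 𝓝[>] 0, n * (2 * h) ≤ ballLength C x (r + h) - ballLength C x (r - h) := by
    have h1 : ∀ᶠ h : ℝ in 𝓝[>] 0, ∀ z ∈ F, Metric.closedBall z h ⊆ U := by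
      refine (eventually_all_finite hFfin).2 fun z hz => ?_
      have hzU : z ∈ U := hrU (Metric.sphere_subset_closedBall (hFsub hz).2)
      obtain ⟨a, ha, haU⟩ := Metric.nhds_basis_closedBall.mem_iff.1 (hU.mem_nhds hzU)
      filter_upwards [hsmall a ha] with h hh
      exact (Metric.closedBall_subset_closedBall hh.le).trans haU
    have h2 : ∀ᶠ h : ℝ in 𝓝[>] 0, ∀ z ∈ F, ∀ w ∈ F, z ≠ w → h + h ≤ dist z w := by
      refine (eventually_all_finite hFfin).2 fun z _ =>
        (eventually_all_finite hFfin).2 fun w _ => ?_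
      by_cases hzw : z = w
      · exact Eventually.of_forall fun h h' => absurd hzw h'
      · filter_upwards [hsmall _ (half_pos (dist_pos.2 hzw))] with h hh _
        linarith
    filter_upwards [h1, h2, hsmall r₀ h₀, self_mem_nhdsWithin] with h hhU hhd hh₀ hpos
    have hpos : 0 < h := hpos
    have hdisj : ((hFfin.toFinset : Set X)).PairwiseDisjoint fun z => C ∩ Metric.ball z h := by
      intro z hz w hw hzw
      exact (Metric.ball_disjoint_ball (hhd z (by simpa using hz) w (by simpa using hw) hzw)).mono
        inter_subset_right inter_subset_right
    have hm : ∀ z : X, MeasurableSet (C ∩ Metric.ball z h) := fun z =>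
      hC.measurableSet.inter Metric.isOpen_ball.measurableSet
    have hsum : (n : ENNReal) * (2 * ENNReal.ofReal h) ≤
        μH[1] (⋃ z ∈ hFfin.toFinset, C ∩ Metric.ball z h) := by
      rw [measure_biUnion_finset hdisj fun z _ => hm z, ← hcard, ← nsmul_eq_mul, ← Finset.sum_const]
      refine Finset.sum_le_sum fun z hz => ?_
      have hz := hFfin.mem_toFinset.1 hz
      exact hC.two_mul_le_measure_ball hne ⟨(hFsub hz).1, hhU z hz
        (Metric.mem_closedBall_self hpos.le)⟩ hh₀.le (hhU z hz)
    have hdisj' : Disjoint (⋃ z ∈ hFfin.toFinset, C ∩ Metric.ball z h)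
        (C ∩ Metric.closedBall x (r - h)) := by
      rw [Set.disjoint_left]
      intro w hw hw'
      obtain ⟨z, hz, hwz⟩ := mem_iUnion₂.1 hw
      have h3 := Metric.mem_ball'.1 hwz.2
      have h4 := Metric.mem_closedBall.1 hw'.2
      have h5 : dist z x = r := (hFsub (hFfin.mem_toFinset.1 hz)).2
      linarith [dist_triangle z w x]
    have hsub : (⋃ z ∈ hFfin.toFinset, C ∩ Metric.ball z h) ∪ (C ∩ Metric.closedBall x (r - h)) ⊆
        C ∩ Metric.closedBall x (r + h) := by
      refine union_subset (iUnion₂_subset fun z hz w hw => ⟨hw.1, ?_⟩)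
        (inter_subset_inter_right _ (Metric.closedBall_subset_closedBall (by linarith)))
      have h3 := Metric.mem_ball.1 hw.2
      have h5 : dist z x = r := (hFsub (hFfin.mem_toFinset.1 hz)).2
      exact Metric.mem_closedBall.2 (by linarith [dist_triangle w z x])
    have htot : (n : ENNReal) * (2 * ENNReal.ofReal h) + μH[1] (C ∩ Metric.closedBall x (r - h)) ≤
        μH[1] (C ∩ Metric.closedBall x (r + h)) := by
      refine le_trans ?_ (measure_mono hsub)
      rw [measure_union hdisj' (hC.measurableSet.inter Metric.isClosed_closedBall.measurableSet)]
      gcongr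
    have := ENNReal.toReal_mono (hC.measure_inter_ne_top _) htot
    rw [ENNReal.toReal_add (by finiteness) (hC.measure_inter_ne_top _)] at this
    simp only [ENNReal.toReal_mul, ENNReal.toReal_natCast, ENNReal.toReal_ofNat,
      ENNReal.toReal_ofReal hpos.le] at this
    rw [le_sub_iff_add_le]
    exact this
  have hder : HasDerivAt (fun h => ballLength C x (r + h) - ballLength C x (r - h))
      (2 * deriv (ballLength C x) r) 0 := by
    have h1 : HasDerivAt (fun h => ballLength C x (r + h)) (deriv (ballLength C x) r) 0 :=
      HasDerivAt.comp_const_add r 0 (by simpa using hd.hasDerivAt)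
    have h2 : HasDerivAt (fun h => ballLength C x (r - h)) (-deriv (ballLength C x) r) 0 :=
      HasDerivAt.comp_const_sub r 0 (by simpa using hd.hasDerivAt)
    exact (h1.sub h2).congr_deriv (by ring)
  have hlim := hder.tendsto_slope_zero_right
  have : (n : ℝ) * 2 ≤ 2 * deriv (ballLength C x) r := by
    refine ge_of_tendsto hlim ?_
    filter_upwards [hev, self_mem_nhdsWithin] with h hh hpos
    have hpos : 0 < h := hpos
    simp only [zero_add, add_zero, sub_zero, sub_self, smul_eq_mul]
    rw [inv_mul_eq_div, le_div_iff₀ hpos]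
    linarith
  linarith

end Metric

section Normed

variable {X : Type*} [NormedAddCommGroup X] [NormedSpace ℝ X] [MeasurableSpace X] [BorelSpace X]
variable {ξ : ℝ → ℝ} {b r₀ : ℝ} {U C : Set X}

theorem ballLength_le_of_encard_le (hC : IsAlmostMinimizing ξ r₀ U C) {x : X}
    (hx : x ∈ C ∩ U) {r : ℝ} (hr : 0 < r) (hr₀ : r ≤ r₀) (hrU : Metric.closedBall x r ⊆ U)
    (hξ : 0 ≤ ξ r) {N : ℕ} (hN : (C ∩ Metric.sphere x r).encard ≤ N) :
    ballLength C x r ≤ (1 + ξ r) * (N * r) := by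
  have := ENNReal.toReal_mono (by finiteness) (hC.measure_le_of_encard_le hx hr hr₀ hrU hN)
  simpa [hr.le, add_nonneg zero_le_one hξ, ballLength] using this

/-- The differential inequality behind monotonicity: where the length is differentiable, its
derivative bounds the number of points on the sphere, and that number bounds the length by
comparison with a cone. -/
theorem one_sub_div_le_deriv_log [SecondCountableTopology X]
    (hC : IsAlmostMinimizing ξ r₀ U C) (hne : C.Nontrivial) (hU : IsOpen U) {x : X}
    (hx : x ∈ C ∩ U) {r : ℝ} (hr : 0 < r) (hr₀ : r ≤ r₀) (hrU : Metric.closedBall x r ⊆ U)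
    (hξ : 0 ≤ ξ r) (hd : DifferentiableAt ℝ (ballLength C x) r) :
    1 / r - ξ r / r ≤ deriv (fun t => Real.log (ballLength C x t)) r := by
  have hpos := hC.ballLength_pos hne hx.1 hr
  rw [deriv.log hd hpos.ne']
  have hle := fun n : ℕ => hC.natCast_le_deriv_ballLength hne (hr.trans_le hr₀) hU hrU hd (n := n)
  obtain ⟨N, hN⟩ : ∃ N : ℕ, (C ∩ Metric.sphere x r).encard = N := by
    refine ⟨_, (ENat.natCast_toNat fun htop => ?_).symm⟩
    obtain ⟨n, hn⟩ := exists_nat_gt (deriv (ballLength C x) r)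
    exact absurd (hle n (htop ▸ le_top)) (not_le.2 hn)
  have h1 := hle N hN.ge
  have h2 := hC.ballLength_le_of_encard_le hx hr hr₀ hrU hξ hN.le
  rw [← sub_div, div_le_div_iff₀ hr hpos]
  have h3 : ballLength C x r ≤ (1 + ξ r) * (deriv (ballLength C x) r * r) :=
    h2.trans (by gcongr)
  have h4 : 0 ≤ deriv (ballLength C x) r := (Nat.cast_nonneg N).trans h1
  rcases le_total 1 (ξ r) with h | h
  · have : (1 - ξ r) * ballLength C x r ≤ 0 := mul_nonpos_of_nonpos_of_nonneg (by linarith) hpos.le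
    have : 0 ≤ deriv (ballLength C x) r * r := by positivity
    linarith
  · have h5 : (1 - ξ r) * ballLength C x r ≤
        (1 - ξ r) * ((1 + ξ r) * (deriv (ballLength C x) r * r)) := by
      gcongr
    have : 0 ≤ ξ r ^ 2 * (deriv (ballLength C x) r * r) := by positivity
    nlinarith

/-- Integration of the differential inequality. The length is only monotone in the radius, but its
logarithm still increases by at least the integral of its derivative. -/
theorem ballLength_div_le_exp [SecondCountableTopology X]
    (hC : IsAlmostMinimizing ξ r₀ U C) (hne : C.Nontrivial) (hU : IsOpen U) (hb : r₀ ≤ b)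
    (hξ : IsDiniGauge ξ b) {x : X} (hx : x ∈ C ∩ U) {s t : ℝ} (hs : 0 < s) (hst : s ≤ t)
    (ht : t ≤ r₀) (htU : Metric.closedBall x t ⊆ U) :
    ballLength C x s * t ≤ Real.exp (∫ ρ in s..t, ξ ρ / ρ) * (s * ballLength C x t) := by
  have hps := hC.ballLength_pos hne hx.1 hs
  have hpt := hC.ballLength_pos hne hx.1 (hs.trans_le hst)
  have ht0 := hs.trans_le hst
  have hmono : MonotoneOn (fun r => Real.log (ballLength C x r)) (uIcc s t) := by
    rw [uIcc_of_le hst]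
    intro u hu v _ huv
    exact Real.log_le_log (hC.ballLength_pos hne hx.1 (hs.trans_le hu.1))
      (hC.ballLength_mono x huv)
  have hint : IntervalIntegrable (fun ρ => ξ ρ / ρ) volume s t := by
    rw [intervalIntegrable_iff_integrableOn_Ioc_of_le hst]
    exact (hξ.dini t ⟨ht0, ht.trans hb⟩).mono_set (Ioc_subset_Ioc_left hs.le)
  have h0 : (0 : ℝ) ∉ uIcc s t := by
    rw [uIcc_of_le hst]; exact fun h => absurd h.1 (not_le.2 hs)
  have hint1 : IntervalIntegrable (fun ρ : ℝ => 1 / ρ) volume s t :=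
    intervalIntegral.intervalIntegrable_one_div (fun ρ hρ h => h0 (h ▸ hρ)) continuousOn_id
  have hupper : ∫ r in s..t, deriv (fun r => Real.log (ballLength C x r)) r ≤
      Real.log (ballLength C x t) - Real.log (ballLength C x s) := by
    have := hmono.intervalIntegral_deriv_mem_uIcc
    rw [uIcc_of_le (sub_nonneg.2 (hmono left_mem_uIcc right_mem_uIcc hst))] at this
    exact this.2
  have hlower : ∫ r in s..t, (1 / r - ξ r / r) ≤
      ∫ r in s..t, deriv (fun r => Real.log (ballLength C x r)) r := by
    refine intervalIntegral.integral_mono_ae_restrict hst (hint1.sub hint)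
      hmono.intervalIntegrable_deriv ?_
    rw [EventuallyLE, ae_restrict_iff' measurableSet_Icc]
    filter_upwards [(hC.ballLength_mono x).ae_differentiableAt] with r hd hr
    have hr0 := hs.trans_le hr.1
    exact hC.one_sub_div_le_deriv_log hne hU hx hr0 (hr.2.trans ht)
      ((Metric.closedBall_subset_closedBall hr.2).trans htU)
      (hξ.nonneg r ⟨hr0, (hr.2.trans ht).trans hb⟩) hd
  rw [intervalIntegral.integral_sub hint1 hint, integral_one_div h0] at hlower
  have hfin := hlower.trans hupper
  rw [← Real.log_le_log_iff (by positivity) (by positivity), Real.log_mul (by positivity)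
    (by positivity), Real.log_mul (by positivity) (by positivity), Real.log_exp,
    Real.log_mul (by positivity) (by positivity)]
  rw [Real.log_div (by positivity) (by positivity)] at hfin
  linarith

/-- Almost monotonicity: on small scales, the quotient of `ballLength C x r` by `r` is
nondecreasing up to a factor close to one, uniformly in `x`. -/
theorem exists_ballLength_mul_le [SecondCountableTopology X]
    (hC : IsAlmostMinimizing ξ r₀ U C) (hne : C.Nontrivial) (hU : IsOpen U) (h₀ : 0 < r₀)
    (hb : r₀ ≤ b) (hξ : IsDiniGauge ξ b) {ε : ℝ} (hε : 0 < ε) :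
    ∃ R, 0 < R ∧ R ≤ r₀ ∧ ξ R ≤ ε ∧ ∀ x ∈ C ∩ U, ∀ s t, 0 < s → s ≤ t → t ≤ R →
      Metric.closedBall x t ⊆ U → ballLength C x s * t ≤ (1 + ε) * (s * ballLength C x t) := by
  have hi : IntegrableOn (fun ρ => ξ ρ / ρ) (Ioc 0 r₀) := hξ.dini r₀ ⟨h₀, hb⟩
  have hlim : Tendsto (fun R => ∫ ρ in (0 : ℝ)..R, ξ ρ / ρ) (𝓝[>] 0) (𝓝 0) := by
    have hc := intervalIntegral.continuousOn_primitive (a := 0) (b := r₀) (μ := volume)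
      (f := fun ρ => ξ ρ / ρ) ((integrableOn_Icc_iff_integrableOn_Ioc).2 hi)
    have := (hc 0 ⟨le_rfl, h₀.le⟩).tendsto
    simp only [Ioc_self, Measure.restrict_empty, integral_zero_measure] at this
    have h2 : Tendsto (fun R => ∫ ρ in Ioc (0 : ℝ) R, ξ ρ / ρ) (𝓝[>] 0) (𝓝 0) := by
      refine this.mono_left (le_trans ?_ (nhdsWithin_mono 0 (Ioc_subset_Icc_self)))
      rw [nhdsWithin_Ioc_eq_nhdsGT h₀]
    refine h2.congr' ?_
    filter_upwards [self_mem_nhdsWithin] with R hR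
    rw [intervalIntegral.integral_of_le (le_of_lt hR)]
  have hexp : Tendsto (fun R => Real.exp (∫ ρ in (0 : ℝ)..R, ξ ρ / ρ)) (𝓝[>] 0) (𝓝 1) := by
    have := (Real.continuous_exp.tendsto 0).comp hlim
    rwa [Real.exp_zero] at this
  obtain ⟨R, hR0, hR1, hR2, hR3⟩ := (((hexp.eventually_lt_const (by linarith : (1 : ℝ) < 1 + ε)).and
    ((hξ.tendsto_zero.eventually_lt_const hε).and
      (((eventually_le_nhds h₀).filter_mono nhdsWithin_le_nhds).and self_mem_nhdsWithin))).exists)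
  have hR3 : 0 < R := hR3
  refine ⟨R, hR3, hR2, hR1.le, fun x hx s t hs hst htR htU => ?_⟩
  refine (hC.ballLength_div_le_exp hne hU hb hξ hx hs hst (htR.trans hR2) htU).trans ?_
  have : 0 < ballLength C x t := hC.ballLength_pos hne hx.1 (hs.trans_le hst)
  gcongr
  refine (Real.exp_le_exp.2 ?_).trans hR0.le
  refine intervalIntegral.integral_mono_interval hs.le hst htR ?_ ?_
  · rw [EventuallyLE, ae_restrict_iff' measurableSet_Ioc]
    refine Eventually.of_forall fun ρ hρ => ?_
    exact div_nonneg (hξ.nonneg ρ ⟨hρ.1, (hρ.2.trans hR2).trans hb⟩) hρ.1.le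
  · rw [intervalIntegrable_iff_integrableOn_Ioc_of_le hR3.le]
    exact hi.mono_set (Ioc_subset_Ioc_right hR2)

end Normed

end IsAlmostMinimizing

/-! ### Splitting by small balls, and parts attached at one point -/

section Split

variable {X : Type*} [PseudoMetricSpace X]

/-- Removing the open ball `B(y, ρ)` splits `K` into two closed connected pieces `A ∋ p` and
`B ∋ q`, both of which reach the boundary of the ball. -/
structure IsSplit (K : Set X) (p q y : X) (ρ : ℝ) (A B : Set X) : Prop where
  pos : 0 < ρ
  isClosed_left : IsClosed A
  isClosed_right : IsClosed B
  isPreconnected_left : IsPreconnected A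
  isPreconnected_right : IsPreconnected B
  union_eq : A ∪ B = K \ Metric.ball y ρ
  disjoint : Disjoint A B
  left_mem : p ∈ A
  right_mem : q ∈ B
  left_sphere : (A ∩ Metric.sphere y ρ).Nonempty
  right_sphere : (B ∩ Metric.sphere y ρ).Nonempty

namespace IsSplit

variable {K A B A' B' : Set X} {p q y : X} {ρ ρ' : ℝ}

theorem symm (h : IsSplit K p q y ρ A B) : IsSplit K q p y ρ B A where
  pos := h.pos
  isClosed_left := h.isClosed_right
  isClosed_right := h.isClosed_left
  isPreconnected_left := h.isPreconnected_right
  isPreconnected_right := h.isPreconnected_left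
  union_eq := union_comm A B ▸ h.union_eq
  disjoint := h.disjoint.symm
  left_mem := h.right_mem
  right_mem := h.left_mem
  left_sphere := h.right_sphere
  right_sphere := h.left_sphere

theorem left_subset (h : IsSplit K p q y ρ A B) : A ⊆ K \ Metric.ball y ρ :=
  h.union_eq ▸ subset_union_left

theorem left_subset_left (h : IsSplit K p q y ρ A B) (h' : IsSplit K p q y ρ' A' B')
    (hρ : ρ' ≤ ρ) : A ⊆ A' := by
  have hsub : A ⊆ A' ∪ B' := by
    rw [h'.union_eq]
    exact h.left_subset.trans (sdiff_subset_sdiff_right (Metric.ball_subset_ball hρ))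
  have := isPreconnected_iff_subset_of_disjoint_closed.1 h.isPreconnected_left A' B'
    h'.isClosed_left h'.isClosed_right hsub (by rw [h'.disjoint.inter_eq, inter_empty])
  exact this.resolve_right fun hAB => disjoint_left.1 h'.disjoint h'.left_mem (hAB h.left_mem)

theorem notMem_right (h : IsSplit K p q y ρ A B) (h' : IsSplit K p q y ρ' A' B') {z : X}
    (hz : z ∈ A) : z ∉ B' := by
  intro hz'
  rcases le_total ρ' ρ with hle | hle
  · exact disjoint_left.1 h'.disjoint (h.left_subset_left h' hle hz) hz'
  · exact disjoint_left.1 h.disjoint hz (h'.symm.left_subset_left h.symm hle hz')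

end IsSplit

/-- The union of `{y}` and the pieces containing `p` of all splittings of `K` around `y`. -/
def splitLeft (K : Set X) (p q y : X) : Set X :=
  insert y {z | ∃ ρ A B, IsSplit K p q y ρ A B ∧ z ∈ A}

variable {K : Set X} {p q y : X}

theorem isPreconnected_splitLeft
    (h : ∀ δ : ℝ, 0 < δ → ∃ ρ A B, ρ < δ ∧ IsSplit K p q y ρ A B) :
    IsPreconnected (splitLeft K p q y) := by
  have hS : IsPreconnected {z | ∃ ρ A B, IsSplit K p q y ρ A B ∧ z ∈ A} := by
    refine isPreconnected_of_forall p ?_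
    rintro z ⟨ρ, A, B, hAB, hz⟩
    exact ⟨A, fun w hw => ⟨ρ, A, B, hAB, hw⟩, hAB.left_mem, hz, hAB.isPreconnected_left⟩
  refine hS.subset_closure (subset_insert _ _) (insert_subset ?_ subset_closure)
  refine Metric.mem_closure_iff.2 fun δ hδ => ?_
  obtain ⟨ρ, A, B, hρ, hAB⟩ := h δ hδ
  obtain ⟨z, hz, hzρ⟩ := hAB.left_sphere
  exact ⟨z, ⟨ρ, A, B, hAB, hz⟩, (Metric.mem_sphere'.1 hzρ).trans_lt hρ⟩

end Split

section Cut

variable {X : Type*} [MetricSpace X] {K : Set X} {p q y : X}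

theorem isClosed_splitLeft (hK : IsClosed K)
    (h : ∀ δ : ℝ, 0 < δ → ∃ ρ A B, ρ < δ ∧ IsSplit K p q y ρ A B) :
    IsClosed (splitLeft K p q y) := by
  rw [splitLeft, insert_eq]
  refine isClosed_of_closure_subset ?_
  rw [closure_union, isClosed_singleton.closure_eq]
  refine union_subset subset_union_left fun w hw => ?_
  by_cases hwy : w = y
  · exact Or.inl hwy
  have hwK : w ∈ K := by
    refine closure_minimal ?_ hK hw
    rintro z ⟨ρ, A, B, hAB, hz⟩
    exact (hAB.left_subset hz).1
  obtain ⟨ρ, A, B, hρ, hAB⟩ := h (dist w y) (dist_pos.2 hwy)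
  have hwAB : w ∈ A ∪ B := by
    rw [hAB.union_eq]
    exact ⟨hwK, fun hb => absurd (Metric.mem_ball.1 hb) (not_lt.2 hρ.le)⟩
  refine Or.inr ⟨ρ, A, B, hAB, hwAB.resolve_right fun hwB => ?_⟩
  have hV : IsOpen (Aᶜ ∩ (Metric.closedBall y ρ)ᶜ) :=
    hAB.isClosed_left.isOpen_compl.inter Metric.isClosed_closedBall.isOpen_compl
  obtain ⟨z, ⟨hzA, hzρ⟩, ρ', A', B', hAB', hz⟩ := mem_closure_iff.1 hw _ hV
    ⟨disjoint_right.1 hAB.disjoint hwB, fun hb => absurd (Metric.mem_closedBall.1 hb) (not_le.2 hρ)⟩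
  have hzAB : z ∈ A ∪ B := by
    rw [hAB.union_eq]
    exact ⟨(hAB'.left_subset hz).1, fun hb => hzρ (Metric.ball_subset_closedBall hb)⟩
  exact hAB'.notMem_right hAB hz (hzAB.resolve_left hzA)

/-- If arbitrarily small balls around `y` split `K` between `p` and `q`, then so does `y`. -/
theorem exists_isCut_of_isSplit (hK : IsClosed K) (hy : y ∈ K)
    (h : ∀ δ : ℝ, 0 < δ → ∃ ρ A B, ρ < δ ∧ IsSplit K p q y ρ A B) :
    ∃ L R, IsCut K p q y L R := by
  have h' : ∀ δ : ℝ, 0 < δ → ∃ ρ A B, ρ < δ ∧ IsSplit K q p y ρ A B := fun δ hδ => by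
    obtain ⟨ρ, A, B, hρ, hAB⟩ := h δ hδ
    exact ⟨ρ, B, A, hρ, hAB.symm⟩
  obtain ⟨ρ₀, A₀, B₀, -, h₀⟩ := h 1 one_pos
  refine ⟨splitLeft K p q y, splitLeft K q p y, isClosed_splitLeft hK h, isClosed_splitLeft hK h',
    isPreconnected_splitLeft h, isPreconnected_splitLeft h', ?_, ?_, ?_, ?_⟩
  · refine subset_antisymm (union_subset ?_ ?_) fun z hz => ?_
    · rintro z (rfl | ⟨ρ, A, B, hAB, hz⟩)
      exacts [hy, (hAB.left_subset hz).1]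
    · rintro z (rfl | ⟨ρ, A, B, hAB, hz⟩)
      exacts [hy, (hAB.left_subset hz).1]
    · by_cases hzy : z = y
      · exact Or.inl (Or.inl hzy)
      obtain ⟨ρ, A, B, hρ, hAB⟩ := h (dist z y) (dist_pos.2 hzy)
      have hzAB : z ∈ A ∪ B := by
        rw [hAB.union_eq]
        exact ⟨hz, fun hb => absurd (Metric.mem_ball.1 hb) (not_lt.2 hρ.le)⟩
      rcases hzAB with hzA | hzB
      · exact Or.inl (Or.inr ⟨ρ, A, B, hAB, hzA⟩)
      · exact Or.inr (Or.inr ⟨ρ, B, A, hAB.symm, hzB⟩)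
  · refine subset_antisymm ?_ (singleton_subset_iff.2 ⟨mem_insert _ _, mem_insert _ _⟩)
    rintro z ⟨hz | ⟨ρ, A, B, hAB, hz⟩, hz' | ⟨ρ', A', B', hAB', hz'⟩⟩
    · exact hz
    · exact hz
    · exact hz'
    · exact absurd hz' (hAB.notMem_right hAB'.symm hz)
  · exact Or.inr ⟨ρ₀, A₀, B₀, h₀, h₀.left_mem⟩
  · exact Or.inr ⟨ρ₀, B₀, A₀, h₀.symm, h₀.right_mem⟩

end Cut

namespace IsAlmostMinimizing

section Exit

variable {X : Type*} [MetricSpace X] [MeasurableSpace X] [BorelSpace X]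
variable {ξ : ℝ → ℝ} {r₀ : ℝ} {U C : Set X}

/-- A part of `C` that is attached to the rest at a single point cannot be contained in a small
ball, as removing it would save too much length. -/
theorem not_subset_closedBall (hC : IsAlmostMinimizing ξ r₀ U C) {y : X} {R : ℝ} (hR : R ≤ r₀)
    (hyU : Metric.closedBall y R ⊆ U)
    (hsmall : ∀ s, 0 < s → s ≤ R → 0 ≤ ξ s ∧ ξ s * ballLength C y s < s)
    {P Q : Set X} {a : X} (hP : IsClosed P) (hQ : IsClosed Q) (hPQ : P ∪ Q = C)
    (ha : P ∩ Q = {a}) (hy : y ∈ Q) (hne : Q.Nontrivial) : ¬ Q ⊆ Metric.closedBall y R := by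
  have := Measure.nullSingletonClass_hausdorff X one_pos
  intro hsub
  have hPC : P ⊆ C := hPQ ▸ subset_union_left
  have hQC : Q ⊆ C := hPQ ▸ subset_union_right
  have hconn : IsPreconnected (P ∪ Q) := hPQ.symm ▸ hC.isPreconnected
  -- the smallest ball around `y` that contains `Q`
  obtain ⟨z, hzQ, hzmax⟩ := (hC.isCompact.of_isClosed_subset hQ hQC).exists_isMaxOn ⟨y, hy⟩
    (LipschitzWith.dist_right y).continuous.continuousOn
  have hzmax : ∀ w ∈ Q, dist y w ≤ dist y z := fun w hw => hzmax hw
  have hs : 0 < dist y z := by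
    obtain ⟨w, hw, hwy⟩ := hne.exists_ne y
    exact (dist_pos.2 hwy.symm).trans_le (hzmax w hw)
  have hsR : dist y z ≤ R := Metric.mem_closedBall'.1 (hsub hzQ)
  set s := dist y z with hsdef
  have hQs : Q ⊆ Metric.closedBall y s := fun w hw => Metric.mem_closedBall'.2 (hzmax w hw)
  have hballU : Metric.closedBall y s ⊆ U := (Metric.closedBall_subset_closedBall hsR).trans hyU
  have hcomp := hC.le_competitor y ⟨hQC hy, hballU (Metric.mem_closedBall_self hs.le)⟩ s hs
    (hsR.trans hR) hballU P ⟨hC.isCompact.of_isClosed_subset hP hPC,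
      hconn.left_of_inter_eq_singleton hP hQ ha, by grind⟩
  have hsum : μH[1] (P ∩ Metric.closedBall y s) + μH[1] Q ≤ μH[1] (C ∩ Metric.closedBall y s) := by
    rw [← measure_union₀ hQ.nullMeasurableSet]
    · exact measure_mono (union_subset (inter_subset_inter_left _ hPC) (subset_inter hQC hQs))
    · refine measure_mono_null (t := {a}) (fun w hw => ?_) (measure_singleton a)
      exact ha ▸ ⟨hw.1.1, hw.2⟩
  have hlow := (hconn.right_of_inter_eq_singleton hP hQ ha).edist_le_hausdorffMeasure hy hzQ
  have hPfin : μH[1] (P ∩ Metric.closedBall y s) ≠ ⊤ :=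
    measure_ne_top_of_subset (inter_subset_left.trans hPC) hC.measure_lt_top.ne
  have hQfin : μH[1] Q ≠ ⊤ := measure_ne_top_of_subset hQC hC.measure_lt_top.ne
  obtain ⟨hξ0, hξs⟩ := hsmall s hs hsR
  have h1 := ENNReal.toReal_mono (by finiteness) hcomp
  have h2 := ENNReal.toReal_mono (hC.measure_inter_ne_top _) hsum
  have h3 := ENNReal.toReal_mono hQfin hlow
  rw [ENNReal.toReal_mul, ENNReal.toReal_ofReal (by linarith)] at h1
  rw [ENNReal.toReal_add hPfin hQfin] at h2
  rw [← dist_edist] at h3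
  change ballLength C y s ≤ _ at h1
  change _ ≤ ballLength C y s at h2
  have h4 : ξ s * (μH[1] (P ∩ Metric.closedBall y s)).toReal ≤ ξ s * ballLength C y s := by
    gcongr
    have : 0 ≤ (μH[1] Q).toReal := ENNReal.toReal_nonneg
    linarith
  linarith

end Exit

end IsAlmostMinimizing

/-! ### Points of large density -/

section Covering

variable {X : Type*} [MetricSpace X] [MeasurableSpace X] [BorelSpace X]
  [SecondCountableTopology X]

/-- The points where a set of finite length has density at least `3 / 2` and is doubling form a null
set: by the Vitali covering theorem they can be covered, up to a null set, by disjoint small balls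
whose total diameter is at most two thirds of the length. -/
theorem hausdorffMeasure_eq_zero_of_three_mul_le {C E : Set X}
    (hCfin : μH[1] C ≠ ⊤) (hEC : E ⊆ C) (D : NNReal)
    (hE : ∀ x ∈ E, ∀ᶠ r : ℝ in 𝓝[>] 0,
      ENNReal.ofReal (3 * r) ≤ μH[1] (C ∩ Metric.closedBall x r) ∧
      μH[1] (C ∩ Metric.closedBall x (3 * r)) ≤ D * μH[1] (C ∩ Metric.closedBall x r)) :
    μH[1] E = 0 := by
  let μ : Measure X := μH[1].restrict C
  have : IsFiniteMeasure μ := ⟨by rw [Measure.restrict_apply_univ]; exact hCfin.lt_top⟩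
  have hμ : ∀ A, A ⊆ C → μ A = μH[1] A := fun A hA => Measure.restrict_eq_self _ hA
  have hμb : ∀ x r, μ (Metric.closedBall x r) = μH[1] (C ∩ Metric.closedBall x r) := fun x r => by
    rw [Measure.restrict_apply Metric.isClosed_closedBall.measurableSet, inter_comm]
  -- `2 / 3` is the quotient of the diameter `2r` of a ball and the lower bound `3r` for its measure
  have main : ∀ G : Set X, IsOpen G → E ⊆ G → μH[1] E ≤ (2 / 3) * μ G := by
    intro G hG hEG
    have hcov : ∀ n : ℕ, ∃ u : Set (X × ℝ), u.Countable ∧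
        (∀ a ∈ u, a.2 ≤ 1 / ((n : ℝ) + 1) ∧ 0 < a.2 ∧ Metric.closedBall a.1 a.2 ⊆ G ∧
          ENNReal.ofReal (3 * a.2) ≤ μ (Metric.closedBall a.1 a.2)) ∧
        u.PairwiseDisjoint (fun a => Metric.closedBall a.1 a.2) ∧
        μ (E \ ⋃ a ∈ u, Metric.closedBall a.1 a.2) = 0 := by
      intro n
      have hn : (0 : ℝ) < 1 / ((n : ℝ) + 1) := by positivity
      let T : Set (X × ℝ) :=
        {a | (a.2 ≤ 1 / ((n : ℝ) + 1) ∧ 0 < a.2 ∧ Metric.closedBall a.1 a.2 ⊆ G ∧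
          ENNReal.ofReal (3 * a.2) ≤ μ (Metric.closedBall a.1 a.2)) ∧
          μ (Metric.closedBall a.1 (3 * a.2)) ≤ D * μ (Metric.closedBall a.1 a.2)}
      have hfine : ∀ x ∈ E, ∀ ε > (0 : ℝ), ∃ a ∈ T, a.2 ≤ ε ∧ a.1 = x := by
        intro x hx ε hε
        obtain ⟨η, hη, hηG⟩ := Metric.nhds_basis_closedBall.mem_iff.1 (hG.mem_nhds (hEG hx))
        have hev : ∀ a : ℝ, 0 < a → ∀ᶠ r : ℝ in 𝓝[>] 0, r ≤ a := fun a ha =>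
          (eventually_le_nhds ha).filter_mono nhdsWithin_le_nhds
        obtain ⟨r, ⟨hr3, hrD⟩, hrε, hrη, hrn, hr0⟩ := ((hE x hx).and ((hev ε hε).and
          ((hev η hη).and ((hev _ hn).and self_mem_nhdsWithin)))).exists
        refine ⟨(x, r), ⟨⟨hrn, hr0, ?_, ?_⟩, ?_⟩, hrε, rfl⟩
        · exact (Metric.closedBall_subset_closedBall hrη).trans hηG
        · rw [hμb]; exact hr3
        · rw [hμb, hμb]; exact hrD
      obtain ⟨u, hut, huc, hud, hu0⟩ := Vitali.exists_disjoint_covering_ae μ E T D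
        (fun a => a.2) (fun a => a.1) (fun a => Metric.closedBall a.1 a.2)
        (fun a _ => subset_rfl) (fun a ha => ha.2)
        (fun a ha => ⟨a.1, Metric.ball_subset_interior_closedBall (Metric.mem_ball_self ha.1.2.1)⟩)
        (fun a _ => Metric.isClosed_closedBall) hfine
      exact ⟨u, huc, fun a ha => (hut ha).1, hud, hu0⟩
    choose u huc hu hud hu0 using hcov
    have hnull : μH[1] (⋃ n, E \ ⋃ a ∈ u n, Metric.closedBall a.1 a.2) = 0 :=
      measure_iUnion_null fun n => by
        rw [← hμ _ (sdiff_subset.trans hEC)]; exact hu0 n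
    have hcount : ∀ n, Countable (u n) := fun n => (huc n).to_subtype
    have hdiam : ∀ n, ∀ a : u n,
        Metric.ediam (Metric.closedBall a.1.1 a.1.2) ≤ ENNReal.ofReal (2 * a.1.2) := by
      intro n a
      refine Metric.ediam_le fun y hy z hz => ?_
      rw [edist_dist]
      refine ENNReal.ofReal_le_ofReal ((dist_triangle_right y z a.1.1).trans ?_)
      linarith [Metric.mem_closedBall.1 hy, Metric.mem_closedBall.1 hz]
    have hlim : Tendsto (fun n : ℕ => ENNReal.ofReal (2 * (1 / ((n : ℝ) + 1)))) atTop (𝓝 0) := by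
      have := ENNReal.tendsto_ofReal
        ((tendsto_one_div_add_atTop_nhds_zero_nat (𝕜 := ℝ)).const_mul 2)
      simpa using this
    have hmain := Measure.hausdorffMeasure_le_liminf_tsum (X := X) (ι := fun n => u n) 1
      (E \ ⋃ n, E \ ⋃ a ∈ u n, Metric.closedBall a.1 a.2) (l := atTop) _ hlim
      (fun n a => Metric.closedBall a.1.1 a.1.2) ?_ ?_
    · rw [measure_sdiff_null hnull] at hmain
      refine hmain.trans (liminf_le_of_le (by isBoundedDefault) fun c hc => ?_)
      obtain ⟨n, hn⟩ := hc.exists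
      refine hn.trans ?_
      calc ∑' a : u n, Metric.ediam (Metric.closedBall a.1.1 a.1.2) ^ (1 : ℝ)
          ≤ ∑' a : u n, (2 / 3) * μ (Metric.closedBall a.1.1 a.1.2) := by
            refine ENNReal.tsum_le_tsum fun a => ?_
            rw [ENNReal.rpow_one]
            refine (hdiam n a).trans ?_
            calc ENNReal.ofReal (2 * a.1.2) = (2 / 3) * ENNReal.ofReal (3 * a.1.2) := by
                  rw [show (2 / 3 : ENNReal) = ENNReal.ofReal (2 / 3) by
                    rw [ENNReal.ofReal_div_of_pos (by norm_num)]; simp,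
                    ← ENNReal.ofReal_mul (by norm_num)]
                  congr 1; ring
              _ ≤ _ := by gcongr; exact (hu n a a.2).2.2.2
        _ = (2 / 3) * μ (⋃ a ∈ u n, Metric.closedBall a.1 a.2) := by
            rw [ENNReal.tsum_mul_left, measure_biUnion (huc n) (hud n)
              fun a _ => Metric.isClosed_closedBall.measurableSet]
        _ ≤ (2 / 3) * μ G := by
            gcongr
            exact iUnion₂_subset fun a ha => (hu n a ha).2.2.1
    · refine Eventually.of_forall fun n a => (hdiam n a).trans (ENNReal.ofReal_le_ofReal ?_)
      linarith [(hu n a a.2).1]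
    · refine Eventually.of_forall fun n x hx => ?_
      by_contra hxu
      refine hx.2 (mem_iUnion.2 ⟨n, hx.1, fun h => hxu ?_⟩)
      obtain ⟨a, ha, hxa⟩ := mem_iUnion₂.1 h
      exact mem_iUnion.2 ⟨⟨a, ha⟩, hxa⟩
  have hfin : μH[1] E ≠ ⊤ := measure_ne_top_of_subset hEC hCfin
  by_contra hne
  have hne' : μH[1] E / 4 ≠ 0 := by simpa using hne
  obtain ⟨G, hEG, hG, hμG⟩ := E.exists_isOpen_le_add μ hne'
  rw [hμ E hEC] at hμG
  have h : μH[1] E ≤ (2 / 3) * (μH[1] E + μH[1] E / 4) := (main G hG hEG).trans (by gcongr)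
  have h' := ENNReal.toReal_mono (by finiteness) h
  rw [ENNReal.toReal_mul, ENNReal.toReal_add hfin (by finiteness), ENNReal.toReal_div,
    ENNReal.toReal_div] at h'
  have : 0 < (μH[1] E).toReal := ENNReal.toReal_pos hne hfin
  norm_num at h'
  linarith

end Covering

/-! ### Points of density one -/

section MetricDensity

theorem eventually_nhdsGT_of_forall_lt {P : ℝ → Prop} {δ : ℝ} (hδ : 0 < δ)
    (h : ∀ r, 0 < r → r < δ → P r) : ∀ᶠ r : ℝ in 𝓝[>] 0, P r := by
  filter_upwards [Ioo_mem_nhdsGT hδ] with r hr using h r hr.1 hr.2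

variable {X : Type*} [MetricSpace X] [MeasurableSpace X] [BorelSpace X]
variable {ξ : ℝ → ℝ} {r₀ : ℝ} {U C : Set X}

namespace IsAlmostMinimizing

theorem two_mul_le_ballLength [SecondCountableTopology X] (hC : IsAlmostMinimizing ξ r₀ U C)
    (hne : C.Nontrivial) {x : X} (hx : x ∈ C ∩ U) {r : ℝ} (hr : 0 ≤ r) (hr₀ : r ≤ r₀)
    (hrU : Metric.closedBall x r ⊆ U) : 2 * r ≤ ballLength C x r := by
  have := hC.natCast_mul_le_ballLength hr 2 fun t ht =>
    hC.two_le_encard_sphere hne hx ht.1 (ht.2.le.trans hr₀)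
      ((Metric.closedBall_subset_closedBall ht.2.le).trans hrU)
  simpa using this

theorem hasLinearDensity_iff_tendsto (hC : IsAlmostMinimizing ξ r₀ U C) {x : X} :
    HasLinearDensity C x 1 ↔ Tendsto (fun r => ballLength C x r / (2 * r)) (𝓝[>] 0) (𝓝 1) := by
  have heq : (fun r : ℝ => μH[1] (C ∩ Metric.closedBall x r) / ENNReal.ofReal (2 * r)) =ᶠ[𝓝[>] 0]
      fun r => ENNReal.ofReal (ballLength C x r / (2 * r)) := by
    filter_upwards [self_mem_nhdsWithin] with r hr
    have hr : 0 < r := hr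
    rw [ENNReal.ofReal_div_of_pos (by linarith), ballLength,
      ENNReal.ofReal_toReal (hC.measure_inter_ne_top _)]
  rw [HasLinearDensity, tendsto_congr' heq]
  constructor
  · intro h
    have h2 := (ENNReal.tendsto_toReal ENNReal.one_ne_top).comp h
    rw [ENNReal.toReal_one] at h2
    refine h2.congr' ?_
    filter_upwards [self_mem_nhdsWithin] with r hr
    have hr : 0 < r := hr
    exact ENNReal.toReal_ofReal (div_nonneg ENNReal.toReal_nonneg (by linarith))
  · intro h
    simpa using ENNReal.tendsto_ofReal h

theorem eventually_ballLength_lt (hC : IsAlmostMinimizing ξ r₀ U C) {x : X}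
    (h : HasLinearDensity C x 1) {c : ℝ} (hc : 2 < c) :
    ∀ᶠ r : ℝ in 𝓝[>] 0, ballLength C x r < c * r := by
  filter_upwards [(hC.hasLinearDensity_iff_tendsto.1 h).eventually_lt_const
    (by linarith : 1 < c / 2), self_mem_nhdsWithin] with r hr hr0
  have hr0 : 0 < r := hr0
  rw [div_lt_iff₀ (by linarith)] at hr
  linarith

/-- If `C` has length less than `3r` in arbitrarily small balls around `x`, then it has exactly two
points on arbitrarily small spheres around `x`, since otherwise it would have at least three
points on all of them. -/
theorem exists_encard_sphere_eq_two [SecondCountableTopology X]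
    (hC : IsAlmostMinimizing ξ r₀ U C) (hne : C.Nontrivial) (hU : IsOpen U) (h₀ : 0 < r₀)
    {x : X} (hx : x ∈ C ∩ U)
    (h : ∀ δ : ℝ, 0 < δ → ∃ r, 0 < r ∧ r < δ ∧ ballLength C x r < 3 * r) {δ : ℝ} (hδ : 0 < δ) :
    ∃ r, 0 < r ∧ r < δ ∧ (C ∩ Metric.sphere x r).encard = 2 := by
  obtain ⟨a, ha, haU⟩ := Metric.nhds_basis_closedBall.mem_iff.1 (hU.mem_nhds hx.2)
  obtain ⟨r, hr0, hr, hlt⟩ := h (min δ (min a r₀)) (lt_min hδ (lt_min ha h₀))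
  obtain ⟨hrδ, hr⟩ := lt_min_iff.1 hr
  obtain ⟨hra, hrr₀⟩ := lt_min_iff.1 hr
  by_contra! hcon
  refine absurd (hC.natCast_mul_le_ballLength hr0.le 3 fun t ht => ?_)
    (not_le.2 (by simpa using hlt))
  have h2 := hC.two_le_encard_sphere hne hx ht.1 (ht.2.le.trans hrr₀.le)
    ((Metric.closedBall_subset_closedBall (ht.2.trans hra).le).trans haU)
  have h3 := lt_of_le_of_ne h2 (hcon t ht.1 (ht.2.trans hrδ)).symm
  have := Order.add_one_le_of_lt h3
  exact_mod_cast this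

end IsAlmostMinimizing

end MetricDensity

section Density

variable {X : Type*} [NormedAddCommGroup X] [NormedSpace ℝ X] [MeasurableSpace X] [BorelSpace X]
variable {ξ : ℝ → ℝ} {b r₀ : ℝ} {U C : Set X}

namespace IsAlmostMinimizing

/-- Comparison with cones bounds the quotient of length and diameter from above along a sequence of
radii, and almost monotonicity extends this to all small radii. -/
theorem hasLinearDensity_of_frequently_encard_le [SecondCountableTopology X]
    (hC : IsAlmostMinimizing ξ r₀ U C) (hne : C.Nontrivial) (hU : IsOpen U) (h₀ : 0 < r₀)
    (hb : r₀ ≤ b) (hξ : IsDiniGauge ξ b) {x : X} (hx : x ∈ C ∩ U)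
    (h : ∀ δ : ℝ, 0 < δ → ∃ r, 0 < r ∧ r < δ ∧ (C ∩ Metric.sphere x r).encard ≤ 2) :
    HasLinearDensity C x 1 := by
  rw [hC.hasLinearDensity_iff_tendsto, tendsto_order]
  have hUx := (eventually_closedBall_subset (hU.mem_nhds hx.2)).filter_mono
    (nhdsWithin_le_nhds (s := Ioi 0))
  have hr₀ : ∀ᶠ r : ℝ in 𝓝[>] 0, r ≤ r₀ :=
    (eventually_le_nhds h₀).filter_mono nhdsWithin_le_nhds
  refine ⟨fun a ha => ?_, fun a ha => ?_⟩
  · filter_upwards [hUx, hr₀, self_mem_nhdsWithin] with r hrU hr hr0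
    have hr0 : 0 < r := hr0
    refine ha.trans_le ((one_le_div (by linarith)).2 ?_)
    exact hC.two_mul_le_ballLength hne hx hr0.le hr hrU
  · obtain ⟨ε, hε, hεa⟩ : ∃ ε : ℝ, 0 < ε ∧ (1 + ε) * (1 + ε) < a := by
      have : Tendsto (fun ε : ℝ => (1 + ε) * (1 + ε)) (𝓝[>] 0) (𝓝 ((1 + 0) * (1 + 0))) := by
        refine Tendsto.mono_left ?_ nhdsWithin_le_nhds
        exact Continuous.tendsto (by fun_prop) 0
      obtain ⟨ε, h1, h2⟩ := ((this.eventually_lt_const (by simpa using ha)).and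
        self_mem_nhdsWithin).exists
      exact ⟨ε, h2, h1⟩
    obtain ⟨R, hR0, hRr₀, hξR, hR⟩ := hC.exists_ballLength_mul_le hne hU h₀ hb hξ hε
    obtain ⟨δ, hδ, hδU⟩ := Metric.nhds_basis_closedBall.mem_iff.1 (hU.mem_nhds hx.2)
    obtain ⟨t, ht0, ht, htN⟩ := h (min R δ) (lt_min hR0 hδ)
    have htR : t ≤ R := ht.le.trans (min_le_left _ _)
    have htU : Metric.closedBall x t ⊆ U :=
      (Metric.closedBall_subset_closedBall (ht.le.trans (min_le_right _ _))).trans hδU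
    have hRb : R ≤ b := hRr₀.trans hb
    have hξt : ξ t ≤ ε := (hξ.mono ⟨ht0, htR.trans hRb⟩ ⟨hR0, hRb⟩ htR).trans hξR
    have hcone := hC.ballLength_le_of_encard_le hx ht0 (htR.trans hRr₀) htU
      (hξ.nonneg t ⟨ht0, htR.trans hRb⟩) (N := 2) htN
    refine eventually_nhdsGT_of_forall_lt ht0 fun s hs0 hst => ?_
    rw [div_lt_iff₀ (by linarith)]
    have h1 := hR x hx s t hs0 hst.le htR htU
    have h2 : ballLength C x t ≤ (1 + ε) * (2 * t) := hcone.trans (by push_cast; gcongr)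
    have h3 : ballLength C x s * t ≤ ((1 + ε) * (1 + ε) * (2 * s)) * t := by
      calc ballLength C x s * t ≤ (1 + ε) * (s * ballLength C x t) := h1
        _ ≤ (1 + ε) * (s * ((1 + ε) * (2 * t))) := by gcongr
        _ = _ := by ring
    exact (le_of_mul_le_mul_right h3 ht0).trans_lt (by gcongr)

theorem hasLinearDensity_of_frequently_ballLength_lt [SecondCountableTopology X]
    (hC : IsAlmostMinimizing ξ r₀ U C) (hne : C.Nontrivial) (hU : IsOpen U) (h₀ : 0 < r₀)
    (hb : r₀ ≤ b) (hξ : IsDiniGauge ξ b) {x : X} (hx : x ∈ C ∩ U)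
    (h : ∀ δ : ℝ, 0 < δ → ∃ r, 0 < r ∧ r < δ ∧ ballLength C x r < 3 * r) :
    HasLinearDensity C x 1 :=
  hC.hasLinearDensity_of_frequently_encard_le hne hU h₀ hb hξ hx fun δ hδ => by
    obtain ⟨r, hr0, hr, hN⟩ := hC.exists_encard_sphere_eq_two hne hU h₀ hx h hδ
    exact ⟨r, hr0, hr, hN.le⟩

/-- Near a point of density one, all densities up to a fixed scale are less than `3 / 2`. -/
theorem exists_forall_ballLength_lt [SecondCountableTopology X]
    (hC : IsAlmostMinimizing ξ r₀ U C) (hne : C.Nontrivial) (hU : IsOpen U) (h₀ : 0 < r₀)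
    (hb : r₀ ≤ b) (hξ : IsDiniGauge ξ b) {x : X} (hx : x ∈ C ∩ U) (h : HasLinearDensity C x 1) :
    ∃ τ, 0 < τ ∧ 2 * τ ≤ r₀ ∧ ∀ y ∈ C, dist y x ≤ τ → Metric.closedBall y (2 * τ) ⊆ U ∧
      ∀ s, 0 < s → s ≤ 2 * τ → ballLength C y s < 3 * s ∧ 0 ≤ ξ s ∧ ξ s ≤ 1 / 10 := by
  obtain ⟨R, hR0, hRr₀, hξR, hR⟩ := hC.exists_ballLength_mul_le hne hU h₀ hb hξ
    (by norm_num : (0 : ℝ) < 1 / 10)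
  obtain ⟨t, hφ, htU, htR, ht0⟩ := ((hC.eventually_ballLength_lt h
    (by norm_num : (2 : ℝ) < 21 / 10)).and
      (((eventually_closedBall_subset (hU.mem_nhds hx.2)).filter_mono nhdsWithin_le_nhds).and
      (((eventually_le_nhds hR0).filter_mono nhdsWithin_le_nhds).and self_mem_nhdsWithin))).exists
  have ht0 : 0 < t := ht0
  have hRb : R ≤ b := hRr₀.trans hb
  -- `B(y, 9t/10)` lies in `B(x, t)`, whence the density quotient at `y` is at most
  -- `(11/10) * (21/10) / (9/10) = 77/30 < 3`
  refine ⟨t / 10, by linarith, by linarith, fun y hy hyx => ?_⟩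
  have hsub : Metric.closedBall y (9 / 10 * t) ⊆ Metric.closedBall x t :=
    Metric.closedBall_subset_closedBall' (by linarith)
  have hyU : y ∈ U := htU (Metric.mem_closedBall.2 (by linarith))
  refine ⟨((Metric.closedBall_subset_closedBall (by linarith)).trans hsub).trans htU,
    fun s hs0 hs => ⟨?_, hξ.nonneg s ⟨hs0, by linarith⟩,
      (hξ.mono ⟨hs0, by linarith⟩ ⟨hR0, hRb⟩ (by linarith)).trans hξR⟩⟩
  have h1 := hR y ⟨hy, hyU⟩ s (9 / 10 * t) hs0 (by linarith) (by linarith) (hsub.trans htU)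
  have h2 := hC.ballLength_le_of_subset hsub
  have h3 : s * ballLength C y (9 / 10 * t) ≤ s * (21 / 10 * t) := by
    gcongr
    linarith
  have h4 : ballLength C y s * t ≤ (77 / 30 * s) * t := by nlinarith
  have := le_of_mul_le_mul_right h4 ht0
  linarith

/-- The points where the density is not one form a null set: there `C` has length at least `3r` in
all small balls of radius `r`. -/
theorem hausdorffMeasure_not_hasLinearDensity [SecondCountableTopology X]
    (hC : IsAlmostMinimizing ξ r₀ U C) (hne : C.Nontrivial) (hU : IsOpen U) (h₀ : 0 < r₀)
    (hb : r₀ ≤ b) (hξ : IsDiniGauge ξ b) :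
    μH[1] {x | x ∈ C ∩ U ∧ ¬ HasLinearDensity C x 1} = 0 := by
  refine measure_null_of_locally_null _ fun x₀ hx₀ => ?_
  obtain ⟨R, hR0, hRr₀, hξR, hR⟩ := hC.exists_ballLength_mul_le hne hU h₀ hb hξ one_pos
  obtain ⟨η, hηU, hηR, hη0⟩ := (((eventually_closedBall_subset (hU.mem_nhds hx₀.1.2)).filter_mono
    (nhdsWithin_le_nhds (s := Ioi 0))).and
    (((eventually_le_nhds hR0).filter_mono nhdsWithin_le_nhds).and self_mem_nhdsWithin)).exists
  have hη0 : 0 < η := hη0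
  refine ⟨{x | x ∈ C ∩ U ∧ ¬ HasLinearDensity C x 1} ∩ Metric.ball x₀ (η / 2),
    inter_mem_nhdsWithin _ (Metric.ball_mem_nhds _ (by linarith)), ?_⟩
  let M : NNReal := ⟨4 * (μH[1] C).toReal / η, by positivity⟩
  refine hausdorffMeasure_eq_zero_of_three_mul_le hC.measure_lt_top.ne
    (fun x hx => hx.1.1.1) M fun x hx => ?_
  obtain ⟨⟨hxCU, hxd⟩, hxη⟩ := hx
  have hsub : Metric.closedBall x (η / 2) ⊆ U :=
    (Metric.closedBall_subset_closedBall' (by linarith [Metric.mem_ball.1 hxη])).trans hηU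
  obtain ⟨δ, hδ, hδ3⟩ : ∃ δ : ℝ, 0 < δ ∧ ∀ r, 0 < r → r < δ → 3 * r ≤ ballLength C x r := by
    by_contra! hcon
    exact hxd (hC.hasLinearDensity_of_frequently_ballLength_lt hne hU h₀ hb hξ hxCU hcon)
  refine eventually_nhdsGT_of_forall_lt (lt_min hδ (by linarith : 0 < η / 6)) fun r hr0 hr => ?_
  obtain ⟨hrδ, hrη⟩ := lt_min_iff.1 hr
  have h3 := hδ3 r hr0 hrδ
  have hmon := hR x hxCU (3 * r) (η / 2) (by linarith) (by linarith) (by linarith) hsub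
  have htot : ballLength C x (η / 2) ≤ (μH[1] C).toReal :=
    ENNReal.toReal_mono hC.measure_lt_top.ne (measure_mono inter_subset_left)
  have hD : ballLength C x (3 * r) ≤ M * ballLength C x r := by
    have h5 : ballLength C x (3 * r) * η ≤ 4 * (μH[1] C).toReal * ballLength C x r := by
      have h6 : 3 * r * ballLength C x (η / 2) ≤ ballLength C x r * (μH[1] C).toReal :=
        mul_le_mul h3 htot ENNReal.toReal_nonneg ENNReal.toReal_nonneg
      linarith
    change _ ≤ 4 * (μH[1] C).toReal / η * ballLength C x r
    rw [div_mul_eq_mul_div, le_div_iff₀ hη0]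
    exact h5
  constructor
  · exact ENNReal.ofReal_le_of_le_toReal h3
  · rw [← ENNReal.ofReal_toReal (hC.measure_inter_ne_top (Metric.closedBall x (3 * r))),
      ← ENNReal.ofReal_toReal (hC.measure_inter_ne_top (Metric.closedBall x r)),
      ← ENNReal.ofReal_coe_nnreal, ← ENNReal.ofReal_mul (NNReal.coe_nonneg M)]
    exact ENNReal.ofReal_le_ofReal hD

end IsAlmostMinimizing

end Density

/-! ### Regularity at points of density one -/

namespace IsAlmostMinimizing

section Splitting

variable {X : Type*} [MetricSpace X] [MeasurableSpace X] [BorelSpace X]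
variable {ξ : ℝ → ℝ} {r₀ : ℝ} {U C : Set X}

/-- If `C` has only finitely many points on a small sphere around `y`, then the outside part of `C`
is disconnected: otherwise the inside part could be dropped. -/
theorem not_isPreconnected_diff_ball (hC : IsAlmostMinimizing ξ r₀ U C) (hne : C.Nontrivial) {y : X}
    (hy : y ∈ C ∩ U) {ρ : ℝ} (hρ : 0 < ρ) (hρ₀ : ρ ≤ r₀) (hρU : Metric.closedBall y ρ ⊆ U)
    (hfin : (C ∩ Metric.sphere y ρ).Finite) : ¬ IsPreconnected (C \ Metric.ball y ρ) := by
  have := Measure.nullSingletonClass_hausdorff X one_pos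
  intro hconn
  have hb := Metric.ball_subset_closedBall (x := y) (ε := ρ)
  have hs := Metric.closedBall_sdiff_ball (x := y) (ε := ρ)
  have h := hC.le_competitor y hy ρ hρ hρ₀ hρU _
    ⟨hC.isCompact.diff Metric.isOpen_ball, hconn, by grind⟩
  have heq : (C \ Metric.ball y ρ) ∩ Metric.closedBall y ρ = C ∩ Metric.sphere y ρ := by
    rw [← hs]; grind
  rw [heq, hfin.measure_zero, mul_zero] at h
  exact absurd (hC.measure_inter_closedBall_pos hne hy.1 hρ) (not_lt.2 h)

/-- A ball `B(y, ρ)` inside `B(x, r)` splits `C ∩ B(x, r)` if `C` has exactly two points on either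
sphere. Both parts of `C` outside `B(y, ρ)` are attached at a single point, so they have to leave
`B(x, r)`, each through one of its two boundary points. -/
theorem exists_isSplit (hC : IsAlmostMinimizing ξ r₀ U C) (hne : C.Nontrivial) {x y p q : X}
    {r ρ R : ℝ} (hy : y ∈ C) (hρ : 0 < ρ) (hρr : Metric.closedBall y ρ ⊆ Metric.ball x r)
    (hrR : Metric.closedBall x r ⊆ Metric.closedBall y R) (hρR : ρ ≤ R) (hR : R ≤ r₀)
    (hRU : Metric.closedBall y R ⊆ U)
    (hsmall : ∀ s, 0 < s → s ≤ R → 0 ≤ ξ s ∧ ξ s * ballLength C y s < s)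
    (htwo : (C ∩ Metric.sphere y ρ).encard = 2) (hpq : C ∩ Metric.sphere x r = {p, q}) :
    ∃ A B, IsSplit (C ∩ Metric.closedBall x r) p q y ρ A B := by
  obtain ⟨a, b, -, hab⟩ := encard_eq_two.1 htwo
  have hyU : y ∈ U := hRU (Metric.mem_closedBall_self (hρ.le.trans hρR))
  have hρb : Metric.ball y ρ ⊆ Metric.closedBall y ρ := Metric.ball_subset_closedBall
  have hρs : Metric.closedBall y ρ \ Metric.ball y ρ = Metric.sphere y ρ :=
    Metric.closedBall_sdiff_ball
  have hrb : Metric.ball x r ⊆ Metric.closedBall x r := Metric.ball_subset_closedBall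
  have hrs : Metric.closedBall x r \ Metric.ball x r = Metric.sphere x r :=
    Metric.closedBall_sdiff_ball
  have hCc := hC.isCompact.isClosed
  have hEc : IsClosed (C \ Metric.ball y ρ) := (hC.isCompact.diff Metric.isOpen_ball).isClosed
  have hDc : IsClosed (C ∩ Metric.closedBall y ρ) := hCc.inter Metric.isClosed_closedBall
  have hKc : IsClosed (C ∩ Metric.closedBall x r) := hCc.inter Metric.isClosed_closedBall
  have hyball : y ∈ Metric.ball y ρ := Metric.mem_ball_self hρ
  -- every part of the outside of `B(y, ρ)` is attached to the inside
  have hattach : ∀ A B : Set X, IsClosed A → IsClosed B → Disjoint A B →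
      A ∪ B = C \ Metric.ball y ρ → A.Nonempty → (A ∩ Metric.sphere y ρ).Nonempty := by
    intro A B hA hB hAB hE hAne
    have hm : ∀ z, (z ∈ A ∨ z ∈ B) ↔ z ∈ C ∧ z ∉ Metric.ball y ρ := fun z => by
      rw [← mem_union, hE, Set.mem_sdiff]
    obtain ⟨w, hwA, hwB | hwD⟩ := hC.isPreconnected.inter_nonempty_of_closed_cover hA
      (hB.union hDc) (by ext z; have := hm z; grind) hAne ⟨y, Or.inr ⟨hy, hρb hyball⟩⟩
    · exact absurd hwB (disjoint_left.1 hAB hwA)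
    · exact ⟨w, hwA, by rw [← hρs]; have := hm w; grind⟩
  -- the part `A` is attached to the rest of `C` at a single point, hence so is the complement of
  -- `A`, which therefore leaves `B(x, r)` through `B`
  have hexit : ∀ A B : Set X, IsClosed A → IsClosed B → Disjoint A B →
      A ∪ B = C \ Metric.ball y ρ → (A ∩ Metric.sphere y ρ).Nonempty →
      (B ∩ Metric.sphere y ρ).Nonempty →
      IsPreconnected A ∧ (B ∩ Metric.sphere x r).Nonempty := by
    intro A B hA hB hAB hE hAs hBs
    have hAB' := disjoint_left.1 hAB
    have hm : ∀ z, (z ∈ A ∨ z ∈ B) ↔ z ∈ C ∧ z ∉ Metric.ball y ρ := fun z => by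
      rw [← mem_union, hE, Set.mem_sdiff]
    obtain ⟨a', ha'⟩ : ∃ a', A ∩ Metric.sphere y ρ = {a'} := by
      obtain ⟨a', ha'⟩ := hAs
      obtain ⟨b', hb'⟩ := hBs
      refine ⟨a', subset_antisymm (fun w hw => ?_) (singleton_subset_iff.2 ha')⟩
      have h1 : w ∈ ({a, b} : Set X) := by rw [← hab]; grind
      have h2 : a' ∈ ({a, b} : Set X) := by rw [← hab]; grind
      have h3 : b' ∈ ({a, b} : Set X) := by rw [← hab]; grind
      grind
    have hQ : IsClosed (B ∪ C ∩ Metric.closedBall y ρ) := hB.union hDc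
    have hcover : A ∪ (B ∪ C ∩ Metric.closedBall y ρ) = C := by
      ext z; have := hm z; grind
    have hinter : A ∩ (B ∪ C ∩ Metric.closedBall y ρ) = {a'} := by
      rw [← ha', ← hρs]; ext z; have := hm z; have := @hAB' z; grind
    refine ⟨(hcover.symm ▸ hC.isPreconnected :
      IsPreconnected (A ∪ _)).left_of_inter_eq_singleton hA hQ hinter, ?_⟩
    have haQ : a' ∈ B ∪ C ∩ Metric.closedBall y ρ := (hinter.ge rfl).2
    have haA : a' ∈ A := (hinter.ge rfl).1
    have hya : y ≠ a' := fun h => by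
      have : y ∈ C \ Metric.ball y ρ := hE ▸ Or.inl (h ▸ haA)
      exact this.2 hyball
    have hout := hC.not_subset_closedBall hR hRU hsmall hA hQ hcover hinter
      (Or.inr ⟨hy, hρb hyball⟩) ⟨y, Or.inr ⟨hy, hρb hyball⟩, a', haQ, hya⟩
    obtain ⟨w, hwQ, hwR⟩ := not_subset.1 hout
    have hwr : w ∉ Metric.closedBall x r := fun h => hwR (hrR h)
    have hwB : w ∈ B := hwQ.resolve_right fun h => hwr (hrb (hρr h.2))
    obtain ⟨z, ⟨hzB, hzr⟩, hz⟩ := hC.isPreconnected.inter_nonempty_of_closed_cover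
      (P := B \ Metric.ball x r) (Q := C ∩ Metric.closedBall x r ∪ A)
      (hB.inter Metric.isOpen_ball.isClosed_compl) (hKc.union hA) (by ext z; have := hm z; grind)
      ⟨w, hwB, fun h => hwr (hrb h)⟩ ⟨a', Or.inr haA⟩
    exact ⟨z, hzB, by rw [← hrs]; grind⟩
  -- inside `B(x, r)` the parts remain connected, as each is cut off at `p` or at `q` only
  have hfinal : ∀ A B : Set X, IsClosed A → IsClosed B → Disjoint A B →
      A ∪ B = C \ Metric.ball y ρ → (A ∩ Metric.sphere y ρ).Nonempty →
      (B ∩ Metric.sphere y ρ).Nonempty → IsPreconnected A → IsPreconnected B → p ∈ A → q ∈ B →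
      IsSplit (C ∩ Metric.closedBall x r) p q y ρ (A ∩ Metric.closedBall x r)
        (B ∩ Metric.closedBall x r) := by
    intro A B hA hB hAB hE hAs hBs hAc hBc hp hq
    have hAB' := disjoint_left.1 hAB
    have hm : ∀ z, (z ∈ A ∨ z ∈ B) ↔ z ∈ C ∧ z ∉ Metric.ball y ρ := fun z => by
      rw [← mem_union, hE, Set.mem_sdiff]
    have hpx : p ∈ C ∩ Metric.sphere x r := hpq.ge (Or.inl rfl)
    have hqx : q ∈ C ∩ Metric.sphere x r := hpq.ge (Or.inr rfl)
    have hconn : ∀ A : Set X, ∀ p, IsClosed A → IsPreconnected A → A ∩ Metric.sphere x r = {p} →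
        IsPreconnected (A ∩ Metric.closedBall x r) := by
      intro A p hA hAc hp
      have h1 : (A ∩ Metric.closedBall x r) ∪ (A \ Metric.ball x r) = A := by grind
      rw [← h1] at hAc
      refine hAc.left_of_inter_eq_singleton (a := p) (hA.inter Metric.isClosed_closedBall)
        (hA.inter Metric.isOpen_ball.isClosed_compl) ?_
      rw [← hp, ← hrs]; grind
    refine ⟨hρ, hA.inter Metric.isClosed_closedBall, hB.inter Metric.isClosed_closedBall,
      hconn A p hA hAc ?_, hconn B q hB hBc ?_, by ext z; have := hm z; grind,
      hAB.mono inter_subset_left inter_subset_left,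
      ⟨hp, Metric.sphere_subset_closedBall hpx.2⟩, ⟨hq, Metric.sphere_subset_closedBall hqx.2⟩,
      ?_, ?_⟩
    · refine subset_antisymm (fun w hw => ?_) (singleton_subset_iff.2 ⟨hp, hpx.2⟩)
      have : w ∈ ({p, q} : Set X) := hpq ▸ ⟨(hE.le (Or.inl hw.1)).1, hw.2⟩
      grind
    · refine subset_antisymm (fun w hw => ?_) (singleton_subset_iff.2 ⟨hq, hqx.2⟩)
      have : w ∈ ({p, q} : Set X) := hpq ▸ ⟨(hE.le (Or.inr hw.1)).1, hw.2⟩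
      grind
    · obtain ⟨w, hw, hws⟩ := hAs
      exact ⟨w, ⟨hw, hrb (hρr (Metric.sphere_subset_closedBall hws))⟩, hws⟩
    · obtain ⟨w, hw, hws⟩ := hBs
      exact ⟨w, ⟨hw, hrb (hρr (Metric.sphere_subset_closedBall hws))⟩, hws⟩
  have hnot := hC.not_isPreconnected_diff_ball hne ⟨hy, hyU⟩ hρ (hρR.trans hR)
    ((Metric.closedBall_subset_closedBall hρR).trans hRU) (hab ▸ toFinite _)
  rw [isPreconnected_iff_subset_of_disjoint_closed] at hnot
  push Not at hnot
  obtain ⟨u, v, hu, hv, huv, hdisj, hnu, hnv⟩ := hnot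
  have hE : (C \ Metric.ball y ρ) ∩ u ∪ (C \ Metric.ball y ρ) ∩ v = C \ Metric.ball y ρ := by
    rw [← inter_union_distrib_left, inter_eq_left.2 huv]
  have hAB : Disjoint ((C \ Metric.ball y ρ) ∩ u) ((C \ Metric.ball y ρ) ∩ v) := by
    exact disjoint_left.2 fun z hz hz' =>
      (eq_empty_iff_forall_notMem.1 hdisj) z ⟨hz.1, hz.2, hz'.2⟩
  have hA := hEc.inter hu
  have hB := hEc.inter hv
  generalize hAdef : (C \ Metric.ball y ρ) ∩ u = A at *
  generalize hBdef : (C \ Metric.ball y ρ) ∩ v = B at *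
  have hAne : A.Nonempty := by
    obtain ⟨w, hw, hwv⟩ := not_subset.1 hnv
    exact ⟨w, (hE.ge hw).resolve_right fun h => hwv (hBdef.ge h).2⟩
  have hBne : B.Nonempty := by
    obtain ⟨w, hw, hwu⟩ := not_subset.1 hnu
    exact ⟨w, (hE.ge hw).resolve_left fun h => hwu (hAdef.ge h).2⟩
  have hE' : B ∪ A = C \ Metric.ball y ρ := union_comm A B ▸ hE
  have hAs := hattach A B hA hB hAB hE hAne
  have hBs := hattach B A hB hA hAB.symm hE' hBne
  obtain ⟨hAc, z, hzB, hz⟩ := hexit A B hA hB hAB hE hAs hBs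
  obtain ⟨hBc, w, hwA, hw⟩ := hexit B A hB hA hAB.symm hE' hBs hAs
  have hz' : z ∈ ({p, q} : Set X) := hpq ▸ ⟨(hE.le (Or.inr hzB)).1, hz⟩
  have hw' : w ∈ ({p, q} : Set X) := hpq ▸ ⟨(hE.le (Or.inl hwA)).1, hw⟩
  have hzw : z ≠ w := fun h => disjoint_left.1 hAB hwA (h ▸ hzB)
  rcases hz' with rfl | rfl <;> rcases hw' with rfl | rfl
  · exact absurd rfl hzw
  · exact ⟨_, _, hfinal B A hB hA hAB.symm hE' hBs hAs hBc hAc hzB hwA⟩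
  · exact ⟨_, _, hfinal A B hA hB hAB hE hAs hBs hAc hBc hwA hzB⟩
  · exact absurd rfl hzw

end Splitting

section Regular

variable {X : Type*} [NormedAddCommGroup X] [NormedSpace ℝ X] [MeasurableSpace X] [BorelSpace X]
  [SecondCountableTopology X]
variable {ξ : ℝ → ℝ} {b r₀ : ℝ} {U C : Set X}

theorem hasLinearDensity_of_mem_regularSet
    (hC : IsAlmostMinimizing ξ r₀ U C) (hne : C.Nontrivial) (hU : IsOpen U) (h₀ : 0 < r₀)
    (hb : r₀ ≤ b) (hξ : IsDiniGauge ξ b) {x : X} (hxU : x ∈ U) (hx : x ∈ regularSet C) :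
    HasLinearDensity C x 1 := by
  refine hC.hasLinearDensity_of_frequently_encard_le hne hU h₀ hb hξ ⟨hx.1, hxU⟩ fun δ hδ => ?_
  obtain ⟨r, hr0, hr, p, q, -, hpq⟩ := hx.2 δ hδ
  rw [frontier_closedBall x hr0.ne'] at hpq
  exact ⟨r, hr0, hr, hpq ▸ (encard_insert_le {q} p).trans_eq (by
    rw [encard_singleton, one_add_one_eq_two])⟩

theorem mem_regularSet_of_hasLinearDensity
    (hC : IsAlmostMinimizing ξ r₀ U C) (hne : C.Nontrivial) (hU : IsOpen U) (h₀ : 0 < r₀)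
    (hb : r₀ ≤ b) (hξ : IsDiniGauge ξ b) {x : X} (hx : x ∈ C ∩ U) (h : HasLinearDensity C x 1) :
    x ∈ regularSet C := by
  obtain ⟨τ, hτ, hτ₀, hτ'⟩ := hC.exists_forall_ballLength_lt hne hU h₀ hb hξ hx h
  have hgood : ∀ y ∈ C, dist y x ≤ τ → ∀ δ : ℝ, 0 < δ →
      ∃ ρ, 0 < ρ ∧ ρ < δ ∧ (C ∩ Metric.sphere y ρ).encard = 2 := by
    intro y hy hyx δ hδ
    obtain ⟨hyU, hys⟩ := hτ' y hy hyx
    refine hC.exists_encard_sphere_eq_two hne hU h₀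
      ⟨hy, hyU (Metric.mem_closedBall_self (by linarith))⟩ (fun δ hδ => ?_) hδ
    obtain ⟨s, hs0, hs⟩ := exists_between (lt_min hδ (by linarith : 0 < 2 * τ))
    exact ⟨s, hs0, hs.trans_le (min_le_left _ _), (hys s hs0 (hs.le.trans (min_le_right _ _))).1⟩
  refine ⟨hx.1, fun δ hδ => ?_⟩
  obtain ⟨r, hr0, hr, htwo⟩ := hgood x hx.1 (by simpa using hτ.le) (min δ τ) (lt_min hδ hτ)
  obtain ⟨hrδ, hrτ⟩ := lt_min_iff.1 hr
  obtain ⟨p, q, hpq, hsph⟩ := encard_eq_two.1 htwo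
  have hp : p ∈ C ∩ Metric.sphere x r := hsph.ge (Or.inl rfl)
  have hq : q ∈ C ∩ Metric.sphere x r := hsph.ge (Or.inr rfl)
  have hpK : p ∈ C ∩ Metric.closedBall x r := ⟨hp.1, Metric.sphere_subset_closedBall hp.2⟩
  have hqK : q ∈ C ∩ Metric.closedBall x r := ⟨hq.1, Metric.sphere_subset_closedBall hq.2⟩
  have hKc : IsClosed (C ∩ Metric.closedBall x r) :=
    hC.isCompact.isClosed.inter Metric.isClosed_closedBall
  refine ⟨r, hr0, hrδ, p, q, ?_, by rw [frontier_closedBall x hr0.ne', hsph]⟩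
  have hint : ∀ y ∈ C, dist y x < r →
      ∃ L R, IsCut (C ∩ Metric.closedBall x r) p q y L R := by
    intro y hy hyr
    obtain ⟨hyU, hys⟩ := hτ' y hy (hyr.le.trans hrτ.le)
    refine exists_isCut_of_isSplit hKc ⟨hy, hyr.le⟩ fun ε hε => ?_
    obtain ⟨ρ, hρ0, hρ, hρtwo⟩ := hgood y hy (hyr.le.trans hrτ.le) (min ε (r - dist y x))
      (lt_min hε (sub_pos.2 hyr))
    obtain ⟨hρε, hρr⟩ := lt_min_iff.1 hρ
    have hyx0 : 0 ≤ dist y x := dist_nonneg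
    have hsmall : ∀ s, 0 < s → s ≤ 2 * τ → 0 ≤ ξ s ∧ ξ s * ballLength C y s < s := by
      intro s hs0 hs
      obtain ⟨h3, hξ0, hξs⟩ := hys s hs0 hs
      have : ξ s * ballLength C y s ≤ 1 / 10 * (3 * s) :=
        mul_le_mul hξs h3.le ENNReal.toReal_nonneg (by norm_num)
      exact ⟨hξ0, by linarith⟩
    obtain ⟨A, B, hAB⟩ := hC.exists_isSplit hne (x := x) (r := r)
      hy hρ0 (Metric.closedBall_subset_ball' (by linarith))
      (Metric.closedBall_subset_closedBall' (by rw [dist_comm]; linarith)) (by linarith) hτ₀ hyU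
      hsmall hρtwo hsph
    exact ⟨ρ, A, B, hρε, hAB⟩
  -- the two pieces of the cut at the centre have a common point
  have hKconn : IsPreconnected (C ∩ Metric.closedBall x r) := by
    obtain ⟨L, R, hLR⟩ := hint x hx.1 (by simpa using hr0)
    exact hLR.isPreconnected
  refine isLipschitzCurve_of_isCut (hC.measure_inter_ne_top _) hpq hpK fun y hy => ?_
  rcases lt_or_eq_of_le (Metric.mem_closedBall.1 hy.2) with hlt | heq
  · exact hint y hy.1 hlt
  · -- the endpoints cut trivially
    have : y ∈ ({p, q} : Set X) := hsph ▸ ⟨hy.1, heq⟩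
    rcases this with rfl | rfl
    · exact ⟨{y}, _, isClosed_singleton, hKc, isPreconnected_singleton, hKconn,
        union_eq_right.2 (singleton_subset_iff.2 hy),
        inter_eq_left.2 (singleton_subset_iff.2 hy), rfl, hqK⟩
    · exact ⟨_, {y}, hKc, isClosed_singleton, hKconn, isPreconnected_singleton,
        union_eq_left.2 (singleton_subset_iff.2 hy),
        inter_eq_right.2 (singleton_subset_iff.2 hy), hpK, rfl⟩

end Regular

end IsAlmostMinimizing

/-! ### The regularity theorem -/

theorem IsLipschitzCurve.nontrivial {X : Type*} [MetricSpace X] {Γ : Set X} {p q : X}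
    (h : IsLipschitzCurve Γ p q) : Γ.Nontrivial := by
  obtain ⟨a, b, γ, K, hab, -, hinj, rfl, -, -⟩ := h
  exact ⟨γ a, ⟨a, left_mem_Icc.2 hab.le, rfl⟩, γ b, ⟨b, right_mem_Icc.2 hab.le, rfl⟩,
    fun h => hab.ne (hinj (left_mem_Icc.2 hab.le) (right_mem_Icc.2 hab.le) h)⟩

theorem mainTheorem7 {X : Type*} [NormedAddCommGroup X] [NormedSpace ℝ X] [CompleteSpace X]
    [TopologicalSpace.SeparableSpace X] [MeasurableSpace X] [BorelSpace X]
    (hdim : 2 ≤ Module.rank ℝ X)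
    (C U : Set X) (hU : IsOpen U) (ξ : ℝ → ℝ) (b r₀ : ℝ) (hr₀ : 0 < r₀) (hb : r₀ ≤ b)
    (hξ : IsDiniGauge ξ b) (hC : IsAlmostMinimizing ξ r₀ U C) :
    U ∩ regularSet C = U ∩ {x | HasLinearDensity C x 1} ∧
      (∃ F : Set X, IsClosed F ∧ U ∩ singularSet C = (U ∩ C) ∩ F) ∧
      μH[1] (U ∩ singularSet C) = 0 := by
  have := UniformSpace.secondCountable_of_separable X
  have := Measure.nullSingletonClass_hausdorff X one_pos
  have hdensC : ∀ x, HasLinearDensity C x 1 → x ∈ C := by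
    intro x hx
    by_contra hxC
    have hev : ∀ᶠ r : ℝ in 𝓝[>] 0,
        μH[1] (C ∩ Metric.closedBall x r) / ENNReal.ofReal (2 * r) = 0 := by
      filter_upwards [(eventually_closedBall_subset
        (hC.isCompact.isClosed.isOpen_compl.mem_nhds hxC)).filter_mono nhdsWithin_le_nhds] with r hr
      rw [(disjoint_right.2 hr).inter_eq]
      simp
    exact zero_ne_one
      (tendsto_nhds_unique (tendsto_const_nhds.congr' (hev.mono fun _ h => h.symm)) hx)
  rcases C.subsingleton_or_nontrivial with hsub | hne
  · -- a point has length zero, hence density zero, and no curve is contained in it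
    have hnull : ∀ A : Set X, μH[1] (C ∩ A) = 0 := fun A =>
      (hsub.anti inter_subset_left).measure_zero _
    have hreg : regularSet C = ∅ := by
      refine eq_empty_of_forall_notMem fun x hx => ?_
      obtain ⟨r, -, -, p, q, hcurve, -⟩ := hx.2 1 one_pos
      exact hcurve.nontrivial.not_subsingleton (hsub.anti inter_subset_left)
    have hdens : {x | HasLinearDensity C x 1} = ∅ := by
      refine eq_empty_of_forall_notMem fun x hx => ?_
      have hx : Tendsto _ _ _ := hx
      simp only [hnull, ENNReal.zero_div] at hx
      exact zero_ne_one (tendsto_nhds_unique tendsto_const_nhds hx)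
    refine ⟨by rw [hreg, hdens], ⟨univ, isClosed_univ, ?_⟩, ?_⟩
    · rw [singularSet, hreg, sdiff_empty, inter_univ]
    · rw [singularSet, hreg, sdiff_empty, inter_comm]
      exact hnull U
  have hiff : ∀ x ∈ U, x ∈ regularSet C ↔ HasLinearDensity C x 1 := fun x hx =>
    ⟨hC.hasLinearDensity_of_mem_regularSet hne hU hr₀ hb hξ hx,
      fun h => hC.mem_regularSet_of_hasLinearDensity hne hU hr₀ hb hξ ⟨hdensC x h, hx⟩ h⟩
  refine ⟨?_, ⟨closure (U ∩ singularSet C), isClosed_closure, ?_⟩, ?_⟩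
  · ext x
    exact and_congr_right (hiff x)
  · refine subset_antisymm (fun x hx => ⟨⟨hx.1, hx.2.1⟩, subset_closure hx⟩) ?_
    rintro x ⟨⟨hxU, hxC⟩, hx⟩
    refine ⟨hxU, hxC, fun hreg => ?_⟩
    obtain ⟨τ, hτ, -, hτ'⟩ := hC.exists_forall_ballLength_lt hne hU hr₀ hb hξ ⟨hxC, hxU⟩
      ((hiff x hxU).1 hreg)
    obtain ⟨y, ⟨hyU, hyC, hysing⟩, hyx⟩ := Metric.mem_closure_iff.1 hx τ hτ
    refine hysing ((hiff y hyU).2 ?_)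
    refine hC.hasLinearDensity_of_frequently_ballLength_lt hne hU hr₀ hb hξ ⟨hyC, hyU⟩
      fun δ hδ => ?_
    obtain ⟨s, hs0, hs⟩ := exists_between (lt_min hδ (by linarith : 0 < 2 * τ))
    exact ⟨s, hs0, hs.trans_le (min_le_left _ _), ((hτ' y hyC (by rw [dist_comm]; exact hyx.le)).2 s
      hs0 (hs.le.trans (min_le_right _ _))).1⟩
  · refine measure_mono_null ?_ (hC.hausdorffMeasure_not_hasLinearDensity hne hU hr₀ hb hξ)
    rintro x ⟨hxU, hxC, hx⟩
    exact ⟨⟨hxC, hxU⟩, fun h => hx ((hiff x hxU).2 h)⟩
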